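/- Let $D=\mathcal N(0,I_n)$ be the standard Gaussian on $\mathbb R^n$, with $L^2$ norm $\|f\|_D=\mathbb E_{x\sim D}[f(x)^2]^{1/2}$. Consider the classes $$\mathcal H_{\mathrm{ReLU}}=\{x\mapsto\pm\max(0,\langle w,x\rangle):\|w\|_2\le 1\},\qquad \mathcal H_{\sigma}=\{x\mapsto\pm\sigma(\langle w,x\rangle):\|w\|_2\le 1\},\quad \sigma(t)=\frac1{1+e^{-t}},$$ of functions on $\mathbb R^n$. A statistical query (SQ) of tolerance $\tau$ to a probability distribution $\mathcal D$ on $\mathbb R^n\times\mathbb R$ is a measurable function $\phi:\mathbb R^n\times\mathbb R\to[-1,1]$, answered by the oracle with an arbitrary value in $[\mathbb E_{\mathcal D}[\phi]-\tau,\ \mathbb E_{\mathcal D}[\phi]+\tau]$. Fix $C>0$. We say that a class $\mathcal H\subset L^2(\mathbb R^n,D)$ can be agnostically learned up to correlation $\epsilon$ using $q$ queries of tolerance $\tau$ if there is a (deterministic, adaptive) learner that asks at most $q$ statistical queries of tolerance $\tau$ and, for every distribution $\mathcal D$ on $\mathbb R^n\times\mathbb R$ whose marginal on $\mathbb R^n$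 is $D$ and whose labels satisfy $y\in[-C,C]$ almost surely, and for all valid oracle answers, outputs a function $f:\mathbb R^n\to\mathbb R$ with $\|f\|_D\le\operatorname{diam}(\mathcal H)/2$ (the diameter being taken in $L^2(\mathbb R^n,D)$) and $$\mathbb E_{(x,y)\sim\mathcal D}[f(x)y]\ \ge\ \max_{h\in\mathcal H}\mathbb E_{(x,y)\sim\mathcal D}[h(x)y]-\epsilon .$$ Then, for every $C>0$, the following hold. 1. There are constants $K,c>0$, depending only on $C$, such that for all $n\ge2$ and all $\epsilon>0$ the class $\mathcal H_{\mathrm{ReLU}}$ can be agnostically learned up to correlation $\epsilon$ using at most $n^{K\epsilon^{-4/3}}$ queries of tolerance $n^{-c\,\epsilon^{-4/3}}\,\epsilon$; that is, $n^{O(\epsilon^{-4/3})}$ queries of tolerance $n^{-\Theta(\epsilon^{-4/3})}\epsilon$. 2. There are constants $K,c>0$ and integers $k,l\ge0$, depending only on $C$, such that for all $n\ge2$ and all $0<\epsilon\le1/2$ the class $\mathcal H_\sigma$ can be agnostically learned up to correlation $\epsilon$ using at most $n^{K s_k(\epsilon)}$ queries of tolerance $n^{-c\,s_l(\epsilon)}\,\epsilon^2$,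 where $s_j(\epsilon)=\log^2(1/\epsilon)\,\bigl(1+\log(1+\log(1/\epsilon))\bigr)^{j}$; that is, $n^{\tilde O(\log^2 1/\epsilon)}$ queries of tolerance $n^{-\tilde\Theta(\log^2 1/\epsilon)}\epsilon^2$. -/

import Mathlib

open MeasureTheory ProbabilityTheory
open scoped ENNReal

/-- `ℝⁿ` with its Euclidean inner product. -/
abbrev Rn (n : ℕ) : Type := EuclideanSpace ℝ (Fin n)

/-- A statistical query: a measurable function `φ : ℝⁿ × ℝ → [-1, 1]`. -/
structure StatQuery (n : ℕ) where
  toFun : Rn n × ℝ → ℝ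
  measurable_toFun : Measurable toFun
  mem_Icc : ∀ z, toFun z ∈ Set.Icc (-1 : ℝ) 1

/-- A (deterministic, adaptive) statistical query learner on `ℝⁿ × ℝ`, as a decision tree: it either
stops and outputs a hypothesis, or asks a query and continues depending on the oracle's answer. -/
inductive SQLearner (n : ℕ) : Type
  | output (f : Rn n → ℝ) : SQLearner n
  | ask (φ : StatQuery n) (next : ℝ → SQLearner n) : SQLearner n

namespace SQLearner

/-- The learner asks at most `q` queries, whatever the answers are. -/
def AsksAtMost {n : ℕ} : SQLearner n → ℕ → Prop
  | output _, _ => True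
  | ask _ _, 0 => False
  | ask _ next, q + 1 => ∀ v : ℝ, (next v).AsksAtMost q

/-- Run against any SQ oracle of tolerance `τ` for `𝒟`, i.e. one that answers each query `φ` by an
arbitrary (possibly adversarial) value within `τ` of `𝔼_𝒟[φ]`, the learner always outputs a
hypothesis satisfying `P`. -/
def AlwaysOutputs {n : ℕ} (𝒟 : Measure (Rn n × ℝ)) (τ : ℝ) (P : (Rn n → ℝ) → Prop) :
    SQLearner n → Prop
  | output f => P f
  | ask φ next =>
      ∀ v : ℝ, |v - ∫ z, φ.toFun z ∂𝒟| ≤ τ → (next v).AlwaysOutputs 𝒟 τ P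

end SQLearner

/-- The diameter of a class of functions in `L²(ℝⁿ, 𝒩(0, Iₙ))`. -/
noncomputable def gaussianDiam {n : ℕ} (H : Set (Rn n → ℝ)) : ℝ≥0∞ :=
  ⨆ h ∈ H, ⨆ h' ∈ H, eLpNorm (h - h') 2 (stdGaussian (Rn n))

/-- The correlation `𝔼_{(x, y) ∼ 𝒟}[f(x) y]`. -/
noncomputable def correlation {n : ℕ} (𝒟 : Measure (Rn n × ℝ)) (f : Rn n → ℝ) : ℝ :=
  ∫ z, f z.1 * z.2 ∂𝒟

/-- `𝒟` is a labeled distribution on `ℝⁿ × ℝ` whose marginal on `ℝⁿ` is `𝒩(0, Iₙ)` and whose labels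
lie in `[-C, C]`. -/
structure IsLabeledGaussian {n : ℕ} (C : ℝ) (𝒟 : Measure (Rn n × ℝ)) : Prop where
  isProbabilityMeasure : IsProbabilityMeasure 𝒟
  marginal : 𝒟.map Prod.fst = stdGaussian (Rn n)
  label_bounded : ∀ᵐ z ∂𝒟, |z.2| ≤ C

/-- The guarantee on the output `f` of an agnostic learner for `H`: `f` lies in the ball of radius
`diam(H)/2` of `L²(𝒩(0, Iₙ))`, and its correlation under `𝒟` is within `ε` of the best in `H`. -/
def IsAgnosticOutput {n : ℕ} (H : Set (Rn n → ℝ)) (ε : ℝ) (𝒟 : Measure (Rn n × ℝ))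
    (f : Rn n → ℝ) : Prop :=
  MemLp f 2 (stdGaussian (Rn n)) ∧
  eLpNorm f 2 (stdGaussian (Rn n)) ≤ gaussianDiam H / 2 ∧
  ∀ h ∈ H, correlation 𝒟 h - ε ≤ correlation 𝒟 f

/-- `H` can be agnostically learned up to correlation `ε` over labeled distributions with Gaussian
marginal and labels in `[-C, C]`, using at most `q` statistical queries of tolerance `τ`. A single
learner has to work for all the distributions. -/
def AgnosticallySQLearnable {n : ℕ} (H : Set (Rn n → ℝ)) (C ε : ℝ) (q : ℕ) (τ : ℝ) : Prop :=
  ∃ L : SQLearner n, L.AsksAtMost q ∧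
    ∀ 𝒟 : Measure (Rn n × ℝ), IsLabeledGaussian C 𝒟 →
      L.AlwaysOutputs 𝒟 τ (IsAgnosticOutput H ε 𝒟)

/-- The class `{x ↦ ± φ(⟨w, x⟩) : ‖w‖₂ ≤ 1}` of units with activation `φ`. -/
def unitClass (φ : ℝ → ℝ) (n : ℕ) : Set (Rn n → ℝ) :=
  {h | ∃ w : Rn n, ‖w‖ ≤ 1 ∧
    (h = (fun x => φ (inner ℝ w x)) ∨ h = (fun x => -φ (inner ℝ w x)))}

/-- The ReLU activation. -/
def relu (t : ℝ) : ℝ := max 0 t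

/-- `log²(1/ε)` times the `k`-th power of `1 + log (1 + log(1/ε))`, a factor polylogarithmic in
`log²(1/ε)`: up to constants, the bounds hidden in `Õ(log²(1/ε))` for `0 < ε ≤ 1/2`. -/
noncomputable def softLogSq (k : ℕ) (ε : ℝ) : ℝ :=
  Real.log (1 / ε) ^ 2 * (1 + Real.log (1 + Real.log (1 / ε))) ^ k

/-! Since labels are bounded by `C`, correlation with the label is a linear functional of norm at
most `C` on L²(D). It therefore suffices to find a finite-dimensional subspace V within δ = ε/(2C)
of the class. On V the functional has a Riesz representer u, whose coordinates in an orthonormal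
basis are correlations, each estimated by one clipped query. Rescaling the estimate of u to norm R =
diam/2 nearly maximizes the functional over the R-ball of V. The class is symmetric, so its members,
and hence their projections to V, have norm at most R (`sub_le_apply_normalize`).

For V take the polynomials of degree at most d, of dimension at most (n+1)^d. As ⟨u, x⟩ is standard
normal for a unit vector u, only the one-variable approximation of t ↦ φ(ρt), 0 ≤ ρ ≤ 1, matters,
and its error is a tail of Hermite coefficients. For the ReLU, whose second derivative is a Dirac
mass, the coefficients are explicit and the tail of their squares telescopes to at most d^(-3/2);
error ε/(2C) needs d ≈ ε^(-4/3). For the sigmoid, m integrations by parts and |σ^(m)| ≤ 2^m m! give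
error 2^(-m) at degree 17m², so d ≈ log²(1/ε).

The tolerance must be of order ε² over the square of the dimension bound. Enlarging the exponent of
n absorbs constants and, for the ReLU, one factor of ε. -/

/-! ### Hermite polynomials as a Hilbert basis of Gaussian L² -/

section HermiteExpansion

open Polynomial Filter Topology

/-- This function dominates every monomial up to a constant, and also the power series of the
Fourier kernel. -/
theorem memLp_exp_mul_abs_gaussianReal (t : ℝ) :
    MemLp (fun x : ℝ => Real.exp (t * |x|)) 2 (gaussianReal 0 1) := by
  rw [memLp_two_iff_integrable_sq (by fun_prop)]
  have h := integrable_exp_mul_abs (integrable_exp_mul_gaussianReal (μ := 0) (v := 1) (2 * t))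
    (integrable_exp_mul_gaussianReal (-(2 * t)))
  refine h.congr (ae_of_all _ fun x => ?_)
  simp only
  rw [← Real.exp_nat_mul]
  congr 1
  push_cast
  ring

theorem memLp_eval_gaussianReal (p : ℝ[X]) :
    MemLp (fun x : ℝ => p.eval x) 2 (gaussianReal 0 1) := by
  induction p using Polynomial.induction_on' with
  | add p q hp hq =>
    simp only [eval_add]
    exact hp.add hq
  | monomial k a =>
    simp only [eval_monomial]
    refine MemLp.const_mul ?_ a
    refine ((memLp_exp_mul_abs_gaussianReal 1).const_mul (k.factorial : ℝ)).mono
      (by fun_prop) (ae_of_all _ fun x => ?_)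
    have h := Real.pow_div_factorial_le_exp |x| (abs_nonneg x) k
    rw [div_le_iff₀ (by positivity)] at h
    rw [Real.norm_eq_abs, Real.norm_eq_abs, abs_pow, abs_of_pos (a := _ * _) (by positivity)]
    simpa [mul_comm] using h

theorem integrable_gaussianReal_iff {f : ℝ → ℝ} :
    Integrable f (gaussianReal 0 1) ↔ Integrable (fun x => gaussianPDFReal 0 1 x * f x) := by
  rw [gaussianReal_of_var_ne_zero _ one_ne_zero, integrable_withDensity_iff_integrable_smul'
    (measurable_gaussianPDF 0 1) (ae_of_all _ fun _ => gaussianPDF_lt_top)]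
  simp

theorem integrable_eval_mul {f : ℝ → ℝ} (hf : MemLp f 2 (gaussianReal 0 1)) (p : ℝ[X]) :
    Integrable (fun x => p.eval x * f x) (gaussianReal 0 1) :=
  (memLp_eval_gaussianReal p).integrable_mul hf

theorem hasDerivAt_gaussianPDFReal (x : ℝ) :
    HasDerivAt (gaussianPDFReal 0 1) (-x * gaussianPDFReal 0 1 x) x := by
  have h : HasDerivAt (fun y : ℝ => -(y - 0) ^ 2 / (2 * ((1 : NNReal) : ℝ))) (-x) x := by
    have := (((hasDerivAt_id x).sub_const (0 : ℝ)).pow 2).neg.div_const (2 * ((1 : NNReal) : ℝ))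
    refine this.congr_deriv ?_
    simp
    ring
  have h' := (h.exp).const_mul (√(2 * Real.pi * ((1 : NNReal) : ℝ)))⁻¹
  rw [gaussianPDFReal_def]
  refine h'.congr_deriv ?_
  ring

/-- The probabilists' Hermite polynomials with real coefficients. -/
noncomputable def hermiteReal (k : ℕ) : ℝ[X] := (hermite k).map (Int.castRingHom ℝ)

theorem hermiteReal_zero : hermiteReal 0 = 1 := by simp [hermiteReal]

theorem hermiteReal_succ (k : ℕ) :
    hermiteReal (k + 1) = X * hermiteReal k - derivative (hermiteReal k) := by
  simp [hermiteReal, hermite_succ, Polynomial.derivative_map]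

theorem monic_hermiteReal (k : ℕ) : (hermiteReal k).Monic := (hermite_monic k).map _

theorem natDegree_hermiteReal (k : ℕ) : (hermiteReal k).natDegree = k := by
  rw [hermiteReal, (hermite_monic k).natDegree_map, natDegree_hermite]

/-- Integration by parts against a Hermite polynomial. -/
theorem integral_hermiteReal_succ_mul {f f' : ℝ → ℝ} (hd : ∀ x, HasDerivAt f (f' x) x)
    (hf : MemLp f 2 (gaussianReal 0 1)) (hf' : MemLp f' 2 (gaussianReal 0 1)) (k : ℕ) :
    ∫ x, (hermiteReal (k + 1)).eval x * f x ∂(gaussianReal 0 1) =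
      ∫ x, (hermiteReal k).eval x * f' x ∂(gaussianReal 0 1) := by
  have h1 := integrable_eval_mul hf (hermiteReal (k + 1))
  have h2 := integrable_eval_mul hf' (hermiteReal k)
  have h3 := integrable_gaussianReal_iff.1 (integrable_eval_mul hf (hermiteReal k))
  have h4 := integrable_gaussianReal_iff.1 (h2.sub h1)
  -- As the density has derivative -x times itself and He_{k+1} = x He_k - He_k', the difference of
  -- the two integrands is a total derivative; integrability takes care of the boundary terms.
  have h5 : ∀ x, HasDerivAt (fun x => gaussianPDFReal 0 1 x * ((hermiteReal k).eval x * f x))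
      (gaussianPDFReal 0 1 x * ((hermiteReal k).eval x * f' x -
        (hermiteReal (k + 1)).eval x * f x)) x := by
    intro x
    refine ((hasDerivAt_gaussianPDFReal x).mul
      (((hermiteReal k).hasDerivAt x).mul (hd x))).congr_deriv ?_
    rw [hermiteReal_succ]
    simp only [Pi.mul_apply, eval_sub, eval_mul, eval_X]
    ring
  have h6 := integral_eq_zero_of_hasDerivAt_of_integrable h5 h4 h3
  have h7 : ∫ x, ((hermiteReal k).eval x * f' x - (hermiteReal (k + 1)).eval x * f x)
      ∂(gaussianReal 0 1) = 0 := by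
    rw [integral_gaussianReal_eq_integral_smul one_ne_zero]
    simpa using h6
  rw [integral_sub h2 h1] at h7
  linarith

/-- Integration by parts k times. For p = He_j the k-th derivative is k! if j = k and 0 if j < k,
which gives norms and orthogonality. -/
theorem integral_hermiteReal_mul_eval (k : ℕ) (p : ℝ[X]) :
    ∫ x, (hermiteReal k).eval x * p.eval x ∂(gaussianReal 0 1) =
      ∫ x, (derivative^[k] p).eval x ∂(gaussianReal 0 1) := by
  induction k generalizing p with
  | zero => simp [hermiteReal_zero]
  | succ k ih =>
    rw [integral_hermiteReal_succ_mul (fun x => p.hasDerivAt x) (memLp_eval_gaussianReal p)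
      (memLp_eval_gaussianReal _), ih, Function.iterate_succ_apply]

theorem integral_hermiteReal_mul_self (k : ℕ) :
    ∫ x, (hermiteReal k).eval x * (hermiteReal k).eval x ∂(gaussianReal 0 1) =
      (k.factorial : ℝ) := by
  rw [integral_hermiteReal_mul_eval]
  have h : derivative^[k] (hermiteReal k) = C (k.factorial : ℝ) := by
    have hd : (derivative^[k] (hermiteReal k)).natDegree = 0 := by
      have := natDegree_iterate_derivative (hermiteReal k) k
      rw [natDegree_hermiteReal] at this
      omega
    rw [eq_C_of_natDegree_eq_zero hd, coeff_iterate_derivative]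
    have h1 : (hermiteReal k).coeff k = 1 := by
      have := monic_hermiteReal k
      rwa [Monic, leadingCoeff, natDegree_hermiteReal] at this
    simp [Nat.descFactorial_self, h1]
  simp [h]

theorem integral_hermiteReal_mul_of_lt {j k : ℕ} (h : j < k) :
    ∫ x, (hermiteReal k).eval x * (hermiteReal j).eval x ∂(gaussianReal 0 1) = 0 := by
  rw [integral_hermiteReal_mul_eval, iterate_derivative_eq_zero (by rwa [natDegree_hermiteReal])]
  simp

/-- A square integrable function orthogonal to all polynomials vanishes. -/
theorem ae_eq_zero_of_integral_pow_mul_eq_zero {f : ℝ → ℝ} (hf : MemLp f 2 (gaussianReal 0 1))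
    (h0 : ∀ k : ℕ, ∫ x, x ^ k * f x ∂(gaussianReal 0 1) = 0) : f =ᵐ[gaussianReal 0 1] 0 := by
  set γ : Measure ℝ := gaussianReal 0 1 with hγ
  wlog hmeas : Measurable f generalizing f
  · have hm := hf.1.aemeasurable
    have hae := hm.ae_eq_mk
    refine hae.trans (this (hf.ae_eq hae) (fun k => ?_) hm.measurable_mk)
    rw [← h0 k]
    refine integral_congr_ae ?_
    filter_upwards [hae] with x hx
    rw [hx]
  have hfi : Integrable f γ := hf.integrable (by norm_num)
  -- The Fourier transform of fγ vanishes: expand the exponential into moments. The dominating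
  -- function exp(|t||x|)|f| is a product of two L² functions.
  have key : ∀ t : ℝ, ∫ x, Complex.exp (t * x * Complex.I) * (f x : ℂ) ∂γ = 0 := by
    intro t
    have hs := hasSum_integral_of_dominated_convergence (μ := γ)
      (F := fun (k : ℕ) (x : ℝ) => ((t * x * Complex.I) ^ k / (k.factorial : ℂ)) * (f x : ℂ))
      (f := fun x => Complex.exp (t * x * Complex.I) * (f x : ℂ))
      (fun k x => ((|t| * |x|) ^ k / (k.factorial : ℝ)) * |f x|)
      (fun k => by fun_prop)
      (fun k => ae_of_all _ fun x => by simp [mul_pow])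
      (ae_of_all _ fun x => (Real.summable_pow_div_factorial _).mul_right _)
      ?_ (ae_of_all _ fun x => ?_)
    · refine hs.unique ?_
      have : ∀ k : ℕ, ∫ x, ((t * x * Complex.I) ^ k / (k.factorial : ℂ)) * (f x : ℂ) ∂γ = 0 := by
        intro k
        have e : ∀ x : ℝ, ((t * x * Complex.I) ^ k / (k.factorial : ℂ)) * (f x : ℂ) =
            ((t * Complex.I) ^ k / (k.factorial : ℂ)) * ((x ^ k * f x : ℝ) : ℂ) := by
          intro x; push_cast; ring
        simp_rw [e]
        rw [integral_const_mul, integral_complex_ofReal, h0 k]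
        simp
      simp_rw [this]
      exact hasSum_zero
    · have e : ∀ x : ℝ, ∑' k : ℕ, ((|t| * |x|) ^ k / (k.factorial : ℝ)) * |f x| =
          Real.exp (|t| * |x|) * |f x| := by
        intro x
        rw [tsum_mul_right, Real.exp_eq_exp_ℝ, NormedSpace.exp_eq_tsum_div]
      simp_rw [e]
      exact (memLp_exp_mul_abs_gaussianReal |t|).integrable_mul hf.abs
    · refine HasSum.mul_right _ ?_
      rw [Complex.exp_eq_exp_ℂ]
      exact NormedSpace.expSeries_div_hasSum_exp _
  have hint : ∀ g : ℝ → ℝ, Measurable g → Integrable g γ → ∀ t : ℝ,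
      Integrable (fun x : ℝ => Complex.exp (t * x * Complex.I) * (g x : ℂ)) γ := by
    intro g hgm hg t
    refine Integrable.mono hg (by fun_prop) (ae_of_all _ fun x => ?_)
    have : (t * x * Complex.I : ℂ) = ((t * x : ℝ) : ℂ) * Complex.I := by push_cast; ring
    rw [norm_mul, this, Complex.norm_exp_ofReal_mul_I]
    simp
  -- Characteristic functions determine finite positive measures, so compare the positive and
  -- negative parts of f as densities.
  set u : ℝ → ℝ := fun x => max (f x) 0
  set v : ℝ → ℝ := fun x => max (-f x) 0
  have hu : Integrable u γ := hfi.pos_part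
  have hv : Integrable v γ := hfi.neg_part
  have hum : Measurable u := by fun_prop
  have hvm : Measurable v := by fun_prop
  have hfin : ∀ g : ℝ → ℝ, Integrable g γ →
      IsFiniteMeasure (γ.withDensity fun x => ENNReal.ofReal (g x)) :=
    fun g hg => isFiniteMeasure_withDensity_ofReal hg.2
  have := hfin u hu
  have := hfin v hv
  have hchar : ∀ g : ℝ → ℝ, Measurable g → (∀ x, 0 ≤ g x) → ∀ t : ℝ,
      charFun (γ.withDensity fun x => ENNReal.ofReal (g x)) t =
        ∫ x, Complex.exp (t * x * Complex.I) * (g x : ℂ) ∂γ := by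
    intro g hg hg0 t
    rw [charFun_apply_real, integral_withDensity_eq_integral_toReal_smul (by fun_prop)
      (ae_of_all _ fun _ => ENNReal.ofReal_lt_top)]
    refine integral_congr_ae (ae_of_all _ fun x => ?_)
    simp [ENNReal.toReal_ofReal (hg0 x), mul_comm]
  have heq : (γ.withDensity fun x => ENNReal.ofReal (u x)) =
      γ.withDensity fun x => ENNReal.ofReal (v x) := by
    refine Measure.ext_of_charFun ?_
    ext t
    rw [hchar u hum (fun x => le_max_right _ _), hchar v hvm (fun x => le_max_right _ _),
      ← sub_eq_zero, ← integral_sub (hint u hum hu t) (hint v hvm hv t), ← key t]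
    refine integral_congr_ae (ae_of_all _ fun x => ?_)
    have : f x = u x - v x := by
      rcases le_total 0 (f x) with h | h <;> simp [u, v, h]
    simp only [this]
    push_cast
    ring
  rw [withDensity_eq_iff (by fun_prop) (by fun_prop)] at heq
  · filter_upwards [heq] with x hx
    rw [ENNReal.ofReal_eq_ofReal_iff (le_max_right _ _) (le_max_right _ _)] at hx
    rcases le_total 0 (f x) with h | h
    · simpa [u, v, h] using hx
    · simpa [u, v, h, eq_comm] using hx
  · exact hu.lintegral_lt_top.ne

/-- The normalized Hermite polynomials as elements of `L²` of the standard Gaussian. -/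
noncomputable def hermiteLp (k : ℕ) : Lp ℝ 2 (gaussianReal 0 1) :=
  MemLp.toLp _ (memLp_eval_gaussianReal (C (√(k.factorial : ℝ))⁻¹ * hermiteReal k))

theorem inner_toLp_toLp {α : Type*} [MeasurableSpace α] {μ : Measure α} {f g : α → ℝ}
    (hf : MemLp f 2 μ) (hg : MemLp g 2 μ) :
    inner ℝ (hf.toLp f) (hg.toLp g) = ∫ x, f x * g x ∂μ := by
  rw [L2.inner_def]
  refine integral_congr_ae ?_
  filter_upwards [hf.coeFn_toLp, hg.coeFn_toLp] with x h1 h2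
  simp [h1, h2, mul_comm]

theorem inner_hermiteLp_toLp {f : ℝ → ℝ} (hf : MemLp f 2 (gaussianReal 0 1)) (k : ℕ) :
    inner ℝ (hermiteLp k) (hf.toLp f) =
      (√(k.factorial : ℝ))⁻¹ * ∫ x, (hermiteReal k).eval x * f x ∂(gaussianReal 0 1) := by
  rw [hermiteLp, inner_toLp_toLp, ← integral_const_mul]
  simp [mul_assoc]

theorem orthonormal_hermiteLp : Orthonormal ℝ hermiteLp := by
  have h : ∀ j k, inner ℝ (hermiteLp j) (hermiteLp k) =
      (√(j.factorial : ℝ))⁻¹ * ((√(k.factorial : ℝ))⁻¹ *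
        ∫ x, (hermiteReal j).eval x * (hermiteReal k).eval x ∂(gaussianReal 0 1)) := by
    intro j k
    rw [hermiteLp.eq_1 k, inner_hermiteLp_toLp, ← integral_const_mul (√(k.factorial : ℝ))⁻¹]
    congr 2
    ext x
    simp only [eval_mul, eval_C]
    ring
  constructor
  · intro k
    have h2 : (inner ℝ (hermiteLp k) (hermiteLp k) : ℝ) = 1 := by
      rw [h, integral_hermiteReal_mul_self]
      have : √(k.factorial : ℝ) ≠ 0 := by positivity
      field_simp
      rw [Real.sq_sqrt (by positivity)]
    rw [real_inner_self_eq_norm_sq] at h2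
    exact (pow_eq_one_iff_of_nonneg (norm_nonneg _) two_ne_zero).1 h2
  · intro j k hjk
    rcases lt_or_gt_of_ne hjk with hlt | hlt
    · change inner ℝ (hermiteLp j) (hermiteLp k) = (0 : ℝ)
      rw [real_inner_comm, h, integral_hermiteReal_mul_of_lt hlt]
      simp
    · change inner ℝ (hermiteLp j) (hermiteLp k) = (0 : ℝ)
      rw [h, integral_hermiteReal_mul_of_lt hlt]
      simp

theorem span_hermiteReal : Submodule.span ℝ (Set.range hermiteReal) = ⊤ := by
  have := Polynomial.Sequence.span (R := ℝ) ⟨hermiteReal, fun k => by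
    rw [degree_eq_natDegree (monic_hermiteReal k).ne_zero, natDegree_hermiteReal]⟩
    (fun k => by
      change IsUnit (hermiteReal k).leadingCoeff
      rw [(monic_hermiteReal k).leadingCoeff]; exact isUnit_one)
  exact this

theorem orthogonal_span_hermiteLp : (Submodule.span ℝ (Set.range hermiteLp))ᗮ = ⊥ := by
  rw [Submodule.eq_bot_iff]
  intro g hg
  have hgm : MemLp g 2 (gaussianReal 0 1) := Lp.memLp g
  have h1 : ∀ k, ∫ x, (hermiteReal k).eval x * g x ∂(gaussianReal 0 1) = 0 := by
    intro k
    have h := (Submodule.mem_orthogonal _ g).1 hg (hermiteLp k) (Submodule.subset_span ⟨k, rfl⟩)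
    rw [← Lp.toLp_coeFn g hgm, inner_hermiteLp_toLp] at h
    have : (√(k.factorial : ℝ))⁻¹ ≠ 0 := by positivity
    exact (mul_eq_zero.1 h).resolve_left this
  have h2 : ∀ p : ℝ[X], ∫ x, p.eval x * g x ∂(gaussianReal 0 1) = 0 := by
    intro p
    have hp : p ∈ Submodule.span ℝ (Set.range hermiteReal) := by rw [span_hermiteReal]; trivial
    induction hp using Submodule.span_induction with
    | mem p hp => obtain ⟨k, rfl⟩ := hp; exact h1 k
    | zero => simp
    | add p q _ _ hp hq =>
      simp only [eval_add, add_mul]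
      rw [integral_add (integrable_eval_mul hgm p) (integrable_eval_mul hgm q), hp, hq, add_zero]
    | smul a p _ hp =>
      simp only [eval_smul, smul_eq_mul, mul_assoc]
      rw [integral_const_mul, hp, mul_zero]
  have h3 := ae_eq_zero_of_integral_pow_mul_eq_zero hgm fun k => by simpa using h2 (X ^ k)
  exact (Lp.eq_zero_iff_ae_eq_zero).2 h3

/-- The Hermite polynomials form a Hilbert basis of `L²` of the standard Gaussian. -/
noncomputable def hermiteBasis : HilbertBasis ℕ ℝ (Lp ℝ 2 (gaussianReal 0 1)) :=
  HilbertBasis.mkOfOrthogonalEqBot orthonormal_hermiteLp orthogonal_span_hermiteLp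

/-- Bessel's inequality; the factorial is the squared norm of the unnormalized He_k. -/
theorem sum_sq_integral_hermiteReal_le {f : ℝ → ℝ} (hf : MemLp f 2 (gaussianReal 0 1))
    (s : Finset ℕ) :
    ∑ k ∈ s, (∫ x, (hermiteReal k).eval x * f x ∂(gaussianReal 0 1)) ^ 2 / (k.factorial : ℝ) ≤
      ‖hf.toLp f‖ ^ 2 := by
  refine le_trans (le_of_eq ?_) (orthonormal_hermiteLp.sum_inner_products_le (hf.toLp f) (s := s))
  refine Finset.sum_congr rfl fun k _ => ?_
  rw [inner_hermiteLp_toLp, norm_mul, mul_pow, Real.norm_eq_abs, Real.norm_eq_abs, sq_abs, sq_abs,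
    inv_pow, Real.sq_sqrt (by positivity)]
  ring

/-- The error of polynomial approximation is bounded by the tail of the Hermite coefficients. -/
theorem exists_polynomial_eLpNorm_sub_le {f : ℝ → ℝ} (hf : MemLp f 2 (gaussianReal 0 1)) (d : ℕ)
    {δ : ℝ} (hδ : 0 ≤ δ)
    (htail : ∀ m, ∑ k ∈ Finset.Ico (d + 1) m,
      (∫ x, (hermiteReal k).eval x * f x ∂(gaussianReal 0 1)) ^ 2 / (k.factorial : ℝ) ≤ δ ^ 2) :
    ∃ p : ℝ[X], p.natDegree ≤ d ∧
      eLpNorm (fun x => f x - p.eval x) 2 (gaussianReal 0 1) ≤ ENNReal.ofReal δ := by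
  set a : ℕ → ℝ := fun k => inner ℝ (hermiteLp k) (hf.toLp f) with ha
  have ha2 : ∀ k, a k ^ 2 =
      (∫ x, (hermiteReal k).eval x * f x ∂(gaussianReal 0 1)) ^ 2 / (k.factorial : ℝ) := by
    intro k
    rw [ha]
    simp only
    rw [inner_hermiteLp_toLp, mul_pow, inv_pow, Real.sq_sqrt (by positivity)]
    ring
  have hsum : HasSum (fun k => a k • hermiteLp k) (hf.toLp f) := by
    have := hermiteBasis.hasSum_repr (hf.toLp f)
    simp only [HilbertBasis.repr_apply_apply, hermiteBasis,
      HilbertBasis.coe_mkOfOrthogonalEqBot] at this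
    exact this
  set p : ℝ[X] := ∑ k ∈ Finset.range (d + 1),
    C (a k) * (C (√(k.factorial : ℝ))⁻¹ * hermiteReal k) with hp
  have hpLp : (memLp_eval_gaussianReal p).toLp _ =
      ∑ k ∈ Finset.range (d + 1), a k • hermiteLp k := by
    refine Lp.ext ?_
    have h1 : ∀ᵐ x ∂(gaussianReal 0 1), ∀ k : ℕ, hermiteLp k x =
        (C (√(k.factorial : ℝ))⁻¹ * hermiteReal k).eval x := by
      rw [ae_all_iff]
      exact fun k => MemLp.coeFn_toLp _
    have h2 : ∀ᵐ x ∂(gaussianReal 0 1), ∀ k : ℕ, (a k • hermiteLp k : Lp ℝ 2 _) x =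
        a k * hermiteLp k x := by
      rw [ae_all_iff]
      exact fun k => Lp.coeFn_smul _ _
    filter_upwards [h1, h2, MemLp.coeFn_toLp (memLp_eval_gaussianReal p),
      Lp.coeFn_finsetSum (Finset.range (d + 1)) (fun k => a k • hermiteLp k)] with x h1 h2 h3 h4
    rw [h3, h4, hp, eval_finsetSum, Finset.sum_apply]
    refine Finset.sum_congr rfl fun k _ => ?_
    rw [h2, h1, eval_mul, eval_C]
  refine ⟨p, ?_, ?_⟩
  · refine natDegree_sum_le_of_forall_le _ _ fun k hk => ?_
    refine (natDegree_C_mul_le _ _).trans ((natDegree_C_mul_le _ _).trans ?_)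
    rw [natDegree_hermiteReal]
    exact Nat.lt_succ_iff.1 (Finset.mem_range.1 hk)
  · have hnorm : ‖hf.toLp f - (memLp_eval_gaussianReal p).toLp _‖ ≤ δ := by
      rw [hpLp]
      -- The error is the limit over m of the norms of the finite blocks from d + 1 to m - 1, each
      -- controlled by `htail`.
      have ht := (hsum.tendsto_sum_nat.sub_const
        (∑ k ∈ Finset.range (d + 1), a k • hermiteLp k)).norm
      refine le_of_tendsto ht ?_
      filter_upwards [eventually_ge_atTop (d + 1)] with m hm
      rw [← Finset.sum_Ico_eq_sub _ hm]
      refine abs_le_of_sq_le_sq' ?_ hδ |>.2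
      rw [← real_inner_self_eq_norm_sq, orthonormal_hermiteLp.inner_sum]
      refine le_trans (le_of_eq ?_) (htail m)
      refine Finset.sum_congr rfl fun k _ => ?_
      rw [← ha2, sq]
      simp
    rw [← MemLp.toLp_sub, Lp.norm_toLp] at hnorm
    exact (ENNReal.le_ofReal_iff_toReal_le (hf.sub (memLp_eval_gaussianReal p)).2.ne hδ).2 hnorm

end HermiteExpansion

/-! ### Polynomial approximation of the ReLU -/

section ReluApproximation

open Polynomial Filter Topology
open scoped Nat

theorem continuous_relu : Continuous relu := by
  unfold relu
  fun_prop

theorem abs_relu_le (t : ℝ) : |relu t| ≤ |t| := by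
  rw [relu, abs_of_nonneg (le_max_left _ _)]
  exact max_le (abs_nonneg t) (le_abs_self t)

theorem memLp_relu : MemLp relu 2 (gaussianReal 0 1) :=
  (memLp_eval_gaussianReal X).mono continuous_relu.aestronglyMeasurable
    (ae_of_all _ fun x => by simpa using abs_relu_le x)

/-- Two integrations by parts would leave He_k against relu'', the Dirac mass at 0. The proof uses
an explicit antiderivative on the half-line instead. -/
theorem integral_hermiteReal_mul_relu (k : ℕ) :
    ∫ x, (hermiteReal (k + 2)).eval x * relu x ∂(gaussianReal 0 1) =
      gaussianPDFReal 0 1 0 * (hermiteReal k).eval 0 := by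
  set G : ℝ → ℝ := fun t =>
    gaussianPDFReal 0 1 t * (-(X * hermiteReal (k + 1) + hermiteReal k)).eval t
  set G' : ℝ → ℝ := fun t => gaussianPDFReal 0 1 t * (X * hermiteReal (k + 2)).eval t
  have hG : ∀ t, HasDerivAt G (G' t) t := by
    intro t
    refine ((hasDerivAt_gaussianPDFReal t).mul
      ((-(X * hermiteReal (k + 1) + hermiteReal k)).hasDerivAt t)).congr_deriv ?_
    simp only [G', hermiteReal_succ (k + 1)]
    rw [hermiteReal_succ k]
    simp
    ring
  have hint : ∀ p : ℝ[X], Integrable (fun t => gaussianPDFReal 0 1 t * p.eval t) := fun p =>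
    integrable_gaussianReal_iff.1 ((memLp_eval_gaussianReal p).integrable (by norm_num))
  have h0 : Tendsto G atTop (𝓝 0) :=
    tendsto_zero_of_hasDerivAt_of_integrableOn_Ioi (a := 0) (fun x _ => hG x)
      (hint _).integrableOn (hint _).integrableOn
  have h1 := integral_Ioi_of_hasDerivAt_of_tendsto' (a := 0) (fun x _ => hG x)
    (hint _).integrableOn h0
  rw [integral_gaussianReal_eq_integral_smul one_ne_zero]
  have h2 : (fun x => gaussianPDFReal 0 1 x • ((hermiteReal (k + 2)).eval x * relu x)) =
      (Set.Ioi 0).indicator G' := by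
    ext x
    by_cases hx : 0 < x
    · rw [Set.indicator_of_mem (Set.mem_Ioi.2 hx)]
      simp only [G', relu, max_eq_right hx.le, smul_eq_mul, eval_mul, eval_X]
      ring
    · rw [Set.indicator_of_notMem (by simpa using hx)]
      simp [relu, max_eq_left (not_lt.1 hx)]
  rw [h2, integral_indicator measurableSet_Ioi, h1]
  simp [G]

/-- The central binomial weight `(2m-1)‼ / (2m)‼`. -/
noncomputable def centralWeight (m : ℕ) : ℝ := ((2 * m - 1)‼ : ℝ) / ((2 * m)‼ : ℝ)

theorem centralWeight_pos (m : ℕ) : 0 < centralWeight m := by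
  have h1 : 0 < (2 * m - 1)‼ := Nat.doubleFactorial_pos _
  have h2 : 0 < (2 * m)‼ := Nat.doubleFactorial_pos _
  unfold centralWeight
  positivity

theorem centralWeight_succ (m : ℕ) :
    centralWeight (m + 1) = centralWeight m * ((2 * m + 1) / (2 * m + 2)) := by
  have h1 : (2 * (m + 1) - 1)‼ = (2 * m + 1) * (2 * m - 1)‼ := by
    rw [show 2 * (m + 1) - 1 = 2 * m + 1 by omega, Nat.doubleFactorial_add_one]
  have h2 : (2 * (m + 1))‼ = (2 * m + 2) * (2 * m)‼ := by
    rw [show 2 * (m + 1) = 2 * m + 2 by omega, Nat.doubleFactorial_add_two]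
  rw [centralWeight, h1, h2, centralWeight]
  push_cast
  rw [div_mul_div_comm]
  congr 1 <;> ring

/-- The induction step is (2m+1)(2m+3) ≤ (2m+2)². -/
theorem centralWeight_sq_le (m : ℕ) : centralWeight m ^ 2 ≤ 1 / (2 * m + 1) := by
  induction m with
  | zero => simp [centralWeight]
  | succ m ih =>
    rw [centralWeight_succ, mul_pow]
    calc centralWeight m ^ 2 * ((2 * m + 1) / (2 * m + 2) : ℝ) ^ 2
        ≤ 1 / (2 * m + 1) * ((2 * m + 1) / (2 * m + 2) : ℝ) ^ 2 := by gcongr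
      _ ≤ 1 / (2 * ((m + 1 : ℕ) : ℝ) + 1) := by
        push_cast
        rw [div_pow, div_mul_div_comm, div_le_div_iff₀ (by positivity) (by positivity)]
        have : (0 : ℝ) ≤ m := Nat.cast_nonneg m
        nlinarith [sq_nonneg (m : ℝ), mul_nonneg this this]

/-- For k = 2m, He_k(0)²/k! is the weight w_m, and w_m - w_{m+1} = w_m/(2m+2). For odd k both sides
vanish, the floors being equal. Hence sums over k telescope. -/
theorem eval_zero_hermiteReal_sq_div (k : ℕ) :
    (hermiteReal k).eval 0 ^ 2 / (k.factorial : ℝ) / (k + 2) =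
      centralWeight ((k + 1) / 2) - centralWeight ((k + 1 + 1) / 2) := by
  have hc : (hermiteReal k).eval 0 = ((hermite k).coeff 0 : ℝ) := by
    rw [← coeff_zero_eq_eval_zero, hermiteReal, coeff_map]
    simp
  rw [hc]
  rcases Nat.even_or_odd' k with ⟨m, rfl | rfl⟩
  · have h := coeff_hermite_explicit m 0
    simp only [add_zero, Nat.choose_zero_right, Nat.cast_one, mul_one] at h
    rw [show (2 * m + 1) / 2 = m by omega, show (2 * m + 1 + 1) / 2 = m + 1 by omega, h,
      centralWeight_succ]
    have h3 : ((2 * m)! : ℝ) = ((2 * m)‼ : ℝ) * ((2 * m - 1)‼ : ℝ) := by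
      rcases m with _ | m
      · simp
      · rw [show 2 * (m + 1) = 2 * m + 1 + 1 by ring, Nat.factorial_eq_mul_doubleFactorial]
        push_cast
        simp
    have h1 : ((2 * m - 1)‼ : ℝ) ≠ 0 := by exact_mod_cast (Nat.doubleFactorial_pos _).ne'
    have h2 : ((2 * m)‼ : ℝ) ≠ 0 := by exact_mod_cast (Nat.doubleFactorial_pos _).ne'
    rw [h3, centralWeight]
    push_cast
    rw [mul_pow, ← pow_mul, mul_comm m 2, pow_mul]
    field_simp
    ring
  · rw [coeff_hermite_of_odd_add (by simp), show (2 * m + 1 + 1) / 2 = m + 1 by omega,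
      show (2 * m + 1 + 1 + 1) / 2 = m + 1 by omega]
    simp

theorem gaussianPDFReal_zero_sq_le : gaussianPDFReal 0 1 0 ^ 2 ≤ 1 := by
  rw [gaussianPDFReal_def]
  simp only [NNReal.coe_one, mul_one, sub_zero, ne_eq, OfNat.ofNat_ne_zero, not_false_eq_true,
    zero_pow, neg_zero, zero_div, Real.exp_zero, inv_pow]
  rw [Real.sq_sqrt (by positivity)]
  exact inv_le_one_of_one_le₀ (by nlinarith [Real.pi_gt_three])

/-- Degree `d` polynomials approximate the ReLU in Gaussian `L²` norm up to `d ^ (-3/4)`. -/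
theorem exists_polynomial_relu {d : ℕ} (hd : 1 ≤ d) {δ : ℝ} (hδ : 0 ≤ δ)
    (h : 1 / (d * √d) ≤ δ ^ 2) :
    ∃ p : ℝ[X], p.natDegree ≤ d ∧
      eLpNorm (fun x => relu x - p.eval x) 2 (gaussianReal 0 1) ≤ ENNReal.ofReal δ := by
  refine exists_polynomial_eLpNorm_sub_le memLp_relu d hδ fun m => le_trans ?_ h
  obtain ⟨J, rfl⟩ : ∃ J, d = J + 1 := ⟨d - 1, by omega⟩
  set W : ℕ → ℝ := fun j => centralWeight ((j + 1) / 2) with hW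
  -- Degrees j + 2 ≥ d + 1 correspond to j ≥ J = d - 1. In (j+2)! = (j+2)(j+1) j!, the factor j+2
  -- feeds the telescoping and j+1 ≥ J+1 is pulled out of the sum.
  have hterm : ∀ j, J ≤ j →
      (∫ x, (hermiteReal (j + 2)).eval x * relu x ∂(gaussianReal 0 1)) ^ 2 /
        ((j + 2).factorial : ℝ) ≤ (W j - W (j + 1)) / (J + 1) := by
    intro j hj
    rw [integral_hermiteReal_mul_relu]
    have e : (((j + 2)! : ℕ) : ℝ) = (j + 2) * ((j + 1) * (j ! : ℝ)) := by
      rw [Nat.factorial_succ, Nat.factorial_succ]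
      push_cast
      ring
    have e2 := eval_zero_hermiteReal_sq_div j
    rw [mul_pow, e]
    have hJ : (J : ℝ) ≤ j := by exact_mod_cast hj
    have hfact : (0 : ℝ) < (j ! : ℝ) := by positivity
    calc gaussianPDFReal 0 1 0 ^ 2 * (hermiteReal j).eval 0 ^ 2 / ((j + 2) * ((j + 1) * (j ! : ℝ)))
        ≤ 1 * (hermiteReal j).eval 0 ^ 2 / ((j + 2) * ((J + 1) * (j ! : ℝ))) := by
          gcongr
          exact gaussianPDFReal_zero_sq_le
      _ = (hermiteReal j).eval 0 ^ 2 / (j ! : ℝ) / (j + 2) / (J + 1) := by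
          field_simp
      _ = (W j - W (j + 1)) / (J + 1) := by rw [e2]
  have hsum : ∑ k ∈ Finset.Ico (J + 1 + 1) m,
      (∫ x, (hermiteReal k).eval x * relu x ∂(gaussianReal 0 1)) ^ 2 / (k.factorial : ℝ) ≤
        W J / (J + 1) := by
    by_cases hm : J + 2 ≤ m
    · obtain ⟨M, rfl⟩ : ∃ M, m = M + 2 := ⟨m - 2, by omega⟩
      rw [← Finset.sum_Ico_add' (fun k => (∫ x, (hermiteReal k).eval x * relu x
        ∂(gaussianReal 0 1)) ^ 2 / (k.factorial : ℝ)) J M 2]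
      refine (Finset.sum_le_sum fun j hj => hterm j (Finset.mem_Ico.1 hj).1).trans ?_
      rw [← Finset.sum_div, Finset.sum_Ico_eq_sum_range]
      have ht := Finset.sum_range_sub' (fun i => W (J + i)) (M - J)
      simp only [← add_assoc, add_zero] at ht
      rw [ht]
      gcongr
      linarith [centralWeight_pos ((J + (M - J) + 1) / 2)]
    · rw [Finset.Ico_eq_empty (by omega)]
      have := centralWeight_pos ((J + 1) / 2)
      simp only [Finset.sum_empty, hW]
      positivity
  refine hsum.trans ?_
  have hWJ : W J ≤ 1 / √((J + 1 : ℕ) : ℝ) := by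
    refine abs_le_of_sq_le_sq' ?_ (by positivity) |>.2
    refine (centralWeight_sq_le _).trans ?_
    rw [div_pow, Real.sq_sqrt (by positivity), one_pow]
    refine one_div_le_one_div_of_le (by positivity) ?_
    have : J + 1 ≤ 2 * ((J + 1) / 2) + 1 := by omega
    exact_mod_cast this
  calc W J / (J + 1) ≤ (1 / √((J + 1 : ℕ) : ℝ)) / (J + 1) := by gcongr
    _ = 1 / (((J + 1 : ℕ) : ℝ) * √((J + 1 : ℕ) : ℝ)) := by
      push_cast
      rw [div_div, mul_comm]

end ReluApproximation

/-! ### Polynomial approximation of the sigmoid -/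

section SigmoidApproximation

open Polynomial

/-- `sigmoidIter m i` is the image of `s ^ i` under the `m`-th iterate of the operator
`g ↦ s (1 - s) g'`, so that `sigmoidIter m i ∘ σ` is the `m`-th derivative of `σ ^ i`. -/
noncomputable def sigmoidIter : ℕ → ℕ → ℝ → ℝ
  | 0, i, s => s ^ i
  | m + 1, i, s => i * (sigmoidIter m i s - sigmoidIter m (i + 1) s)

/-- From σ' = σ(1-σ) one gets (σ^i)' = i(σ^i - σ^(i+1)). The recursion performs this differentiation
innermost, so the induction on m runs over all i. -/
theorem hasDerivAt_sigmoidIter (ρ : ℝ) (m i : ℕ) (t : ℝ) :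
    HasDerivAt (fun t => sigmoidIter m i (Real.sigmoid (ρ * t)))
      (ρ * sigmoidIter (m + 1) i (Real.sigmoid (ρ * t))) t := by
  induction m generalizing i with
  | zero =>
    have h1 : HasDerivAt (fun t => ρ * t) ρ t := by simpa using (hasDerivAt_id t).const_mul ρ
    have h2 := ((Real.hasDerivAt_sigmoid (ρ * t)).comp t h1).pow i
    refine h2.congr_deriv ?_
    simp only [sigmoidIter, Function.comp]
    rcases i with _ | i
    · simp
    · simp only [Nat.add_sub_cancel]
      ring
  | succ m ih =>
    refine (((ih i).sub (ih (i + 1))).const_mul (i : ℝ)).congr_deriv ?_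
    simp only [sigmoidIter]
    ring

/-- Each step doubles the number of terms and multiplies by an index that grows by at most one;
powers of s are at most 1. For i = 1 the bound is 2^m m!. -/
theorem abs_sigmoidIter_le {s : ℝ} (h0 : 0 ≤ s) (h1 : s ≤ 1) (m i : ℕ) :
    |sigmoidIter m i s| ≤ 2 ^ m * (i.ascFactorial m : ℝ) := by
  induction m generalizing i with
  | zero =>
    simp only [sigmoidIter, pow_zero, Nat.ascFactorial_zero, Nat.cast_one, mul_one]
    rw [abs_of_nonneg (by positivity)]
    exact pow_le_one₀ h0 h1
  | succ m ih =>
    have h2 : (i : ℝ) * ((i + 1).ascFactorial m : ℝ) = (i.ascFactorial (m + 1) : ℝ) := by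
      rw [Nat.ascFactorial_succ, ← Nat.succ_ascFactorial]
      push_cast
      rfl
    have h3 : (i.ascFactorial m : ℝ) ≤ ((i + 1).ascFactorial m : ℝ) := by
      exact_mod_cast Nat.ascFactorial_le m (Nat.le_succ i)
    rw [sigmoidIter, abs_mul, Nat.abs_cast]
    calc (i : ℝ) * |sigmoidIter m i s - sigmoidIter m (i + 1) s|
        ≤ i * (2 ^ m * ((i + 1).ascFactorial m : ℝ) + 2 ^ m * ((i + 1).ascFactorial m : ℝ)) := by
          gcongr
          refine (abs_sub _ _).trans (add_le_add ((ih i).trans ?_) (ih (i + 1)))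
          gcongr
      _ = 2 ^ (m + 1) * (i * ((i + 1).ascFactorial m : ℝ)) := by ring
      _ = _ := by rw [h2]

/-- The `m`-th derivative of `t ↦ σ (ρ t)`. -/
noncomputable def sigmoidDeriv (ρ : ℝ) (m : ℕ) (t : ℝ) : ℝ :=
  ρ ^ m * sigmoidIter m 1 (Real.sigmoid (ρ * t))

theorem sigmoidDeriv_zero (ρ : ℝ) : sigmoidDeriv ρ 0 = fun t => Real.sigmoid (ρ * t) := by
  ext t
  simp [sigmoidDeriv, sigmoidIter]

theorem hasDerivAt_sigmoidDeriv (ρ : ℝ) (m : ℕ) (t : ℝ) :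
    HasDerivAt (sigmoidDeriv ρ m) (sigmoidDeriv ρ (m + 1) t) t := by
  refine ((hasDerivAt_sigmoidIter ρ m 1 t).const_mul (ρ ^ m)).congr_deriv ?_
  rw [sigmoidDeriv, pow_succ]
  ring

theorem abs_sigmoidDeriv_le {ρ : ℝ} (h0 : 0 ≤ ρ) (h1 : ρ ≤ 1) (m : ℕ) (t : ℝ) :
    |sigmoidDeriv ρ m t| ≤ 2 ^ m * (m.factorial : ℝ) := by
  rw [sigmoidDeriv, abs_mul, abs_of_nonneg (pow_nonneg h0 m)]
  have h2 := abs_sigmoidIter_le (Real.sigmoid_nonneg (ρ * t)) (Real.sigmoid_le_one (ρ * t)) m 1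
  rw [Nat.one_ascFactorial] at h2
  exact (mul_le_of_le_one_left (abs_nonneg _) (pow_le_one₀ h0 h1)).trans h2

theorem memLp_sigmoidDeriv {ρ : ℝ} (h0 : 0 ≤ ρ) (h1 : ρ ≤ 1) (m : ℕ) :
    MemLp (sigmoidDeriv ρ m) 2 (gaussianReal 0 1) := by
  have hc : Continuous (sigmoidDeriv ρ m) :=
    continuous_iff_continuousAt.2 fun t => (hasDerivAt_sigmoidDeriv ρ m t).continuousAt
  exact MemLp.of_bound hc.aestronglyMeasurable _
    (ae_of_all _ fun t => by simpa using abs_sigmoidDeriv_le h0 h1 m t)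

theorem integral_hermiteReal_mul_sigmoidDeriv {ρ : ℝ} (h0 : 0 ≤ ρ) (h1 : ρ ≤ 1) (m j k : ℕ) :
    ∫ x, (hermiteReal (k + m)).eval x * sigmoidDeriv ρ j x ∂(gaussianReal 0 1) =
      ∫ x, (hermiteReal k).eval x * sigmoidDeriv ρ (j + m) x ∂(gaussianReal 0 1) := by
  induction m generalizing j with
  | zero => rfl
  | succ m ih =>
    rw [← add_assoc, integral_hermiteReal_succ_mul (hasDerivAt_sigmoidDeriv ρ j)
      (memLp_sigmoidDeriv h0 h1 _) (memLp_sigmoidDeriv h0 h1 _), ih, add_assoc, add_comm 1 m]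

/-- Polynomials of degree `17 m²` approximate the sigmoid in Gaussian `L²` norm up to `2 ^ (-m)`. -/
theorem exists_polynomial_sigmoid {ρ : ℝ} (h0 : 0 ≤ ρ) (h1 : ρ ≤ 1) {m : ℕ} (hm : 1 ≤ m) :
    ∃ p : ℝ[X], p.natDegree ≤ 17 * m ^ 2 ∧
      eLpNorm (fun x => Real.sigmoid (ρ * x) - p.eval x) 2 (gaussianReal 0 1) ≤
        ENNReal.ofReal ((1 / 2) ^ m) := by
  have hmem : MemLp (fun x => Real.sigmoid (ρ * x)) 2 (gaussianReal 0 1) := by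
    rw [← sigmoidDeriv_zero]
    exact memLp_sigmoidDeriv h0 h1 0
  refine exists_polynomial_eLpNorm_sub_le hmem (17 * m ^ 2) (by positivity) fun M => ?_
  set F := memLp_sigmoidDeriv h0 h1 m
  have hmR : (1 : ℝ) ≤ m := by exact_mod_cast hm
  have hFnorm : ‖F.toLp _‖ ≤ 2 ^ m * (m.factorial : ℝ) := by
    have := Lp.norm_le_of_ae_bound (f := F.toLp _) (C := 2 ^ m * (m.factorial : ℝ))
      (by positivity) ?_
    · simpa [measureUnivNNReal] using this
    · filter_upwards [F.coeFn_toLp] with x hx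
      rw [hx]
      exact abs_sigmoidDeriv_le h0 h1 m x
  have hbase : (2 ^ m * (m.factorial : ℝ)) ^ 2 ≤ (4 * (m : ℝ) ^ 2) ^ m := by
    have h : (m.factorial : ℝ) ≤ (m : ℝ) ^ m := by exact_mod_cast Nat.factorial_le_pow m
    calc (2 ^ m * (m.factorial : ℝ)) ^ 2 ≤ (2 ^ m * (m : ℝ) ^ m) ^ 2 := by gcongr
      _ = (4 * (m : ℝ) ^ 2) ^ m := by
        rw [mul_pow, mul_pow, ← pow_mul, ← pow_mul, ← pow_mul, mul_comm m 2, pow_mul]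
        norm_num
  -- Trade m Hermite indices for m derivatives; (k+m)! ≥ k!(k+1)^m gains (16m²)^m. Bessel for the
  -- m-th derivative costs (4m²)^m, leaving 4^(-m).
  have hterm : ∀ k, 16 * m ^ 2 ≤ k →
      (∫ x, (hermiteReal (k + m)).eval x * Real.sigmoid (ρ * x) ∂(gaussianReal 0 1)) ^ 2 /
        ((k + m).factorial : ℝ) ≤
      (∫ x, (hermiteReal k).eval x * sigmoidDeriv ρ m x ∂(gaussianReal 0 1)) ^ 2 /
        (k.factorial : ℝ) * ((16 * (m : ℝ) ^ 2) ^ m)⁻¹ := by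
    intro k hk
    have h := integral_hermiteReal_mul_sigmoidDeriv h0 h1 m 0 k
    rw [sigmoidDeriv_zero, zero_add] at h
    rw [h, ← div_eq_mul_inv, div_div]
    refine div_le_div_of_nonneg_left (by positivity) (by positivity) ?_
    have h2 : k.factorial * (16 * m ^ 2) ^ m ≤ (k + m).factorial :=
      (Nat.mul_le_mul_left _ (Nat.pow_le_pow_left (hk.trans (Nat.le_succ k)) m)).trans
        Nat.factorial_mul_pow_le_factorial
    exact_mod_cast h2
  -- Ensures that after the shift by m every index in the tail is at least 16m².
  have hd : m + 16 * m ^ 2 ≤ 17 * m ^ 2 + 1 := by nlinarith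
  by_cases hM : m ≤ M
  · obtain ⟨M, rfl⟩ : ∃ M', M = M' + m := ⟨M - m, by omega⟩
    obtain ⟨D, hD⟩ : ∃ D, 17 * m ^ 2 + 1 = D + m := ⟨17 * m ^ 2 + 1 - m, by omega⟩
    rw [hD, ← Finset.sum_Ico_add' (fun k => (∫ x, (hermiteReal k).eval x *
      Real.sigmoid (ρ * x) ∂(gaussianReal 0 1)) ^ 2 / (k.factorial : ℝ)) D M m]
    refine (Finset.sum_le_sum fun k hk => hterm k ?_).trans ?_
    · have := (Finset.mem_Ico.1 hk).1
      omega
    · rw [← Finset.sum_mul]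
      have hb := sum_sq_integral_hermiteReal_le F (Finset.Ico D M)
      have hb2 : ‖F.toLp _‖ ^ 2 ≤ (4 * (m : ℝ) ^ 2) ^ m :=
        (pow_le_pow_left₀ (norm_nonneg _) hFnorm 2).trans hbase
      calc _ ≤ (4 * (m : ℝ) ^ 2) ^ m * ((16 * (m : ℝ) ^ 2) ^ m)⁻¹ := by
            gcongr
            exact hb.trans hb2
        _ = ((1 / 2) ^ m) ^ 2 := by
            rw [← inv_pow, ← mul_pow, ← pow_mul, mul_comm m 2, pow_mul]
            congr 1
            field_simp
            norm_num
  · rw [Finset.Ico_eq_empty (by nlinarith)]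
    simp only [Finset.sum_empty]
    positivity

end SigmoidApproximation

/-! ### Learning a class close to a finite-dimensional subspace -/

section Learner

variable {n : ℕ}

/-- A learner asking a fixed list of queries, whose output is computed from the answers. -/
theorem SQLearner.exists_nonadaptive (N : ℕ) (φ : Fin N → StatQuery n)
    (F : (Fin N → ℝ) → (Rn n → ℝ)) :
    ∃ L : SQLearner n, L.AsksAtMost N ∧
      ∀ (𝒟 : Measure (Rn n × ℝ)) (τ : ℝ) (P : (Rn n → ℝ) → Prop),
        (∀ v : Fin N → ℝ, (∀ i, |v i - ∫ z, (φ i).toFun z ∂𝒟| ≤ τ) → P (F v)) →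
          L.AlwaysOutputs 𝒟 τ P := by
  induction N with
  | zero =>
    exact ⟨.output (F Fin.elim0), trivial, fun 𝒟 τ P h => h _ fun i => i.elim0⟩
  | succ N ih =>
    choose L hL1 hL2 using fun a : ℝ =>
      ih (fun i => φ i.succ) (fun v => F (Fin.cons a v : Fin (N + 1) → ℝ))
    refine ⟨.ask (φ 0) L, fun a => hL1 a, fun 𝒟 τ P h a ha => hL2 a 𝒟 τ P fun v hv => h _ ?_⟩
    intro i
    refine Fin.cases ?_ (fun j => ?_) i
    · simpa using ha
    · simpa using hv j

/-- The query `clip (e(x) y / B)` estimating the correlation with `e`. -/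
noncomputable def clipQuery (e : Rn n → ℝ) (he : Measurable e) (B : ℝ) : StatQuery n where
  toFun z := max (-1) (min 1 (e z.1 * z.2 / B))
  measurable_toFun := by fun_prop
  mem_Icc z := ⟨le_max_left _ _, max_le (by norm_num) (min_le_left _ _)⟩

/-- Clipping changes nothing if |s| ≤ B and otherwise costs |s| - B ≤ s²/B, so a second moment
controls the bias even for unbounded s. -/
theorem abs_sub_mul_clip_le {B : ℝ} (hB : 0 < B) (s : ℝ) :
    |s - B * max (-1) (min 1 (s / B))| ≤ s ^ 2 / B := by
  rw [le_div_iff₀ hB]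
  rcases le_total (s / B) (-1) with h | h
  · rw [min_eq_right (by linarith), max_eq_left h]
    rw [div_le_iff₀ hB] at h
    rw [abs_of_nonpos (by linarith)]
    nlinarith
  · rcases le_total (s / B) 1 with h' | h'
    · rw [min_eq_right h', max_eq_right h, mul_div_cancel₀ _ hB.ne']
      simpa using sq_nonneg s
    · rw [min_eq_left h', max_eq_right (by norm_num)]
      rw [le_div_iff₀ hB] at h'
      rw [abs_of_nonneg (by linarith)]
      nlinarith

variable {C : ℝ} {𝒟 : Measure (Rn n × ℝ)}

theorem IsLabeledGaussian.measurePreserving_fst (h : IsLabeledGaussian C 𝒟) :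
    MeasurePreserving Prod.fst 𝒟 (stdGaussian (Rn n)) :=
  ⟨measurable_fst, h.marginal⟩

theorem IsLabeledGaussian.memLp_snd (h : IsLabeledGaussian C 𝒟) :
    MemLp (fun z : Rn n × ℝ => z.2) 2 𝒟 :=
  have := h.isProbabilityMeasure
  MemLp.of_bound (by fun_prop) C h.label_bounded

/-- The correlation as a bounded linear functional on `L²`. -/
theorem IsLabeledGaussian.exists_correlation_functional (hC : 0 ≤ C) (h : IsLabeledGaussian C 𝒟) :
    ∃ ℓ : Lp ℝ 2 (stdGaussian (Rn n)) →ₗ[ℝ] ℝ,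
      (∀ (f : Rn n → ℝ) (hf : MemLp f 2 (stdGaussian (Rn n))),
        correlation 𝒟 f = ℓ (hf.toLp f)) ∧
      ∀ g, |ℓ g| ≤ C * ‖g‖ := by
  have := h.isProbabilityMeasure
  have hmp := h.measurePreserving_fst
  have hY := h.memLp_snd
  refine ⟨(innerₛₗ ℝ (hY.toLp _)).comp (Lp.compMeasurePreservingₗ ℝ Prod.fst hmp),
    fun f hf => ?_, fun g => ?_⟩
  · simp only [LinearMap.comp_apply, innerₛₗ_apply_apply]
    change _ = inner ℝ (hY.toLp _) (Lp.compMeasurePreserving Prod.fst hmp (hf.toLp f))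
    rw [Lp.toLp_compMeasurePreserving hf hmp, inner_toLp_toLp, correlation]
    simp [mul_comm]
  · simp only [LinearMap.comp_apply, innerₛₗ_apply_apply]
    change |inner ℝ (hY.toLp _) (Lp.compMeasurePreserving Prod.fst hmp g)| ≤ _
    refine (abs_real_inner_le_norm _ _).trans ?_
    rw [Lp.norm_compMeasurePreserving]
    gcongr
    have h2 := Lp.norm_le_of_ae_bound (f := hY.toLp _) hC (C := C) ?_
    · simpa [measureUnivNNReal] using h2
    · filter_upwards [hY.coeFn_toLp, h.label_bounded] with z hz hz2
      rw [hz]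
      exact hz2

theorem IsLabeledGaussian.abs_correlation_sub_clipQuery_le
    (h : IsLabeledGaussian C 𝒟) {e : Rn n → ℝ} (he : Measurable e)
    (hem : MemLp e 2 (stdGaussian (Rn n))) (he1 : ∫ x, e x * e x ∂(stdGaussian (Rn n)) = 1) {B : ℝ}
    (hB : 0 < B) :
    |correlation 𝒟 e - B * ∫ z, (clipQuery e he B).toFun z ∂𝒟| ≤ C ^ 2 / B := by
  have := h.isProbabilityMeasure
  have hmp := h.measurePreserving_fst
  have hem' : MemLp (fun z : Rn n × ℝ => e z.1) 2 𝒟 := hem.comp_measurePreserving hmp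
  have hi1 : Integrable (fun z : Rn n × ℝ => e z.1 * z.2) 𝒟 := hem'.integrable_mul h.memLp_snd
  have hi2 : Integrable (fun z => (clipQuery e he B).toFun z) 𝒟 := by
    refine Integrable.of_bound (clipQuery e he B).measurable_toFun.aestronglyMeasurable 1
      (ae_of_all _ fun z => ?_)
    exact abs_le.2 ((clipQuery e he B).mem_Icc z)
  have hi3 : Integrable (fun z : Rn n × ℝ => C ^ 2 / B * (e z.1 * e z.1)) 𝒟 :=
    (hem'.integrable_mul hem').const_mul _
  have he2 : ∫ z, C ^ 2 / B * (e z.1 * e z.1) ∂𝒟 = C ^ 2 / B := by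
    rw [integral_const_mul]
    have : ∫ z, e z.1 * e z.1 ∂𝒟 = 1 := by
      rw [← he1, ← h.marginal, integral_map (f := fun x => e x * e x) measurable_fst.aemeasurable
        (he.mul he).aestronglyMeasurable]
    rw [this, mul_one]
  rw [correlation, ← integral_const_mul, ← integral_sub hi1 (hi2.const_mul B), ← he2]
  rw [← Real.norm_eq_abs]
  refine norm_integral_le_of_norm_le hi3 ?_
  filter_upwards [h.label_bounded] with z hz
  refine (abs_sub_mul_clip_le hB (e z.1 * z.2)).trans ?_
  have hz2 : z.2 ^ 2 ≤ C ^ 2 := sq_le_sq' (by linarith [abs_le.1 hz]) (abs_le.1 hz).2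
  rw [div_mul_eq_mul_div]
  gcongr
  nlinarith [mul_self_nonneg (e z.1)]

theorem gaussianDiam_le_two {H : Set (Rn n → ℝ)}
    (hmem : ∀ h ∈ H, MemLp h 2 (stdGaussian (Rn n)))
    (hnorm : ∀ h ∈ H, eLpNorm h 2 (stdGaussian (Rn n)) ≤ 1) : gaussianDiam H ≤ 2 := by
  refine iSup₂_le fun h hh => iSup₂_le fun h' hh' => ?_
  refine (eLpNorm_sub_le (hmem h hh).1 (hmem h' hh').1 (by norm_num)).trans ?_
  exact (add_le_add (hnorm h hh) (hnorm h' hh')).trans_eq one_add_one_eq_two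

/-- The distance from h to -h is 2‖h‖. Thus every competitor lies in the ball allowed to the
learner. -/
theorem eLpNorm_le_half_gaussianDiam {H : Set (Rn n → ℝ)} (hsymm : ∀ h ∈ H, -h ∈ H)
    {h : Rn n → ℝ} (hh : h ∈ H) :
    eLpNorm h 2 (stdGaussian (Rn n)) ≤ gaussianDiam H / 2 := by
  have h1 : eLpNorm (h - -h) 2 (stdGaussian (Rn n)) ≤ gaussianDiam H :=
    le_iSup₂_of_le h hh (le_iSup₂_of_le (-h) (hsymm h hh) le_rfl)
  have h2 : h - -h = (2 : ℝ) • h := by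
    ext x
    simp
    ring
  rw [h2, eLpNorm_const_smul] at h1
  have h3 : ‖(2 : ℝ)‖ₑ = 2 := by
    rw [Real.enorm_eq_ofReal zero_le_two]
    simp
  rw [h3] at h1
  rwa [ENNReal.le_div_iff_mul_le (by simp) (by simp), mul_comm]

/-- A noisy copy `w` of `u` gives, after normalization, nearly the optimal correlation with `u`. -/
theorem norm_sub_le_inner_normalize {E : Type*} [NormedAddCommGroup E] [InnerProductSpace ℝ E]
    (u w : E) : ‖u‖ - 2 * ‖u - w‖ ≤ ‖w‖⁻¹ * inner ℝ u w := by
  -- With 0⁻¹ = 0 the right side is 0 and the left side is -‖u‖.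
  rcases eq_or_ne w 0 with rfl | hw
  · simp
    linarith [norm_nonneg u]
  · have hw' : 0 < ‖w‖ := norm_pos_iff.2 hw
    have h1 : inner ℝ u w = inner ℝ (u - w) w + ‖w‖ ^ 2 := by
      rw [inner_sub_left, real_inner_self_eq_norm_sq]
      ring
    have h2 := (abs_le.1 (abs_real_inner_le_norm (u - w) w)).1
    have h3 : ‖u‖ ≤ ‖u - w‖ + ‖w‖ := by simpa using norm_add_le (u - w) w
    rw [inv_mul_eq_div, le_div_iff₀ hw']
    nlinarith

theorem norm_sub_orthogonalProjectionOnto_le {E : Type*} [NormedAddCommGroup E]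
    [InnerProductSpace ℝ E] (V : Submodule ℝ E) [V.HasOrthogonalProjection] (x : E) {g : E}
    (hg : g ∈ V) : ‖x - V.orthogonalProjectionOnto x‖ ≤ ‖x - g‖ := by
  have h := V.starProjection_minimal x
  rw [Submodule.starProjection_apply] at h
  rw [h]
  exact ciInf_le ⟨0, by rintro _ ⟨y, rfl⟩; positivity⟩ (⟨g, hg⟩ : V)

/-- Maximizing a linear functional over a ball, given its approximate values on an orthonormal
basis of a subspace. -/
theorem sub_le_apply_normalize {E : Type*} [NormedAddCommGroup E] [InnerProductSpace ℝ E]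
    {V : Submodule ℝ E} [FiniteDimensional ℝ V] {ι : Type*} [Fintype ι]
    (b : OrthonormalBasis ι ℝ V) {ℓ : E →ₗ[ℝ] ℝ} (hC : 0 ≤ C) (hℓ : ∀ g, |ℓ g| ≤ C * ‖g‖)
    {v : ι → ℝ} {η : ℝ} (hη0 : 0 ≤ η) (hη : ∀ i, |ℓ (b i) - v i| ≤ η) {R : ℝ} (hR0 : 0 ≤ R)
    (hR1 : R ≤ 1) {x g : E} {δ : ℝ} (hx : ‖x‖ ≤ R) (hg : g ∈ V) (hxg : ‖x - g‖ ≤ δ) :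
    ℓ x - (2 * (√(Fintype.card ι) * η) + C * δ) ≤
      ℓ ((R * ‖∑ i, v i • b i‖⁻¹) • ∑ i, v i • b i : V) := by
  -- u is the Riesz representer of ℓ on V, and w its estimate from the answers.
  set u : V := ∑ i, ℓ (b i) • b i with hu
  set w : V := ∑ i, v i • b i with hw
  have hinner : ∀ g : V, inner ℝ u g = ℓ g := by
    intro g
    conv_rhs => rw [← b.sum_repr' g]
    rw [hu, sum_inner]
    simp only [Submodule.coe_sum, Submodule.coe_smul, map_sum, map_smul, smul_eq_mul]
    refine Finset.sum_congr rfl fun i _ => ?_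
    rw [real_inner_smul_left, mul_comm]
  have hdist : ‖u - w‖ ≤ √(Fintype.card ι) * η := by
    refine abs_le_of_sq_le_sq' ?_ (by positivity) |>.2
    have e : u - w = ∑ i, (ℓ (b i) - v i) • b i := by
      simp only [hu, hw, sub_smul]
      rw [← Finset.sum_sub_distrib]
    rw [e, ← real_inner_self_eq_norm_sq, b.orthonormal.inner_sum, mul_pow,
      Real.sq_sqrt (Nat.cast_nonneg _)]
    calc _ ≤ ∑ _i : ι, η ^ 2 := by
          refine Finset.sum_le_sum fun i _ => ?_
          simp only [conj_trivial, ← sq]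
          exact sq_le_sq' (abs_le.1 (hη i)).1 (abs_le.1 (hη i)).2
      _ = Fintype.card ι * η ^ 2 := by simp
  have hf : ℓ ((R * ‖w‖⁻¹) • w : V) = R * (‖w‖⁻¹ * inner ℝ u w) := by
    rw [← hinner, real_inner_smul_right, mul_assoc]
  have h1 : ‖x - V.orthogonalProjectionOnto x‖ ≤ δ :=
    (norm_sub_orthogonalProjectionOnto_le V x hg).trans hxg
  -- The first term is at most Cδ, the second at most R‖u‖, while the output achieves at least R(‖u‖
  -- - 2‖u - w‖).
  have h2 : ℓ x = ℓ (x - V.orthogonalProjectionOnto x) +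
      inner ℝ u (V.orthogonalProjectionOnto x) := by
    rw [hinner, ← map_add, sub_add_cancel]
  have h3 := (abs_le.1 (hℓ (x - V.orthogonalProjectionOnto x))).2
  have h4 : inner ℝ u (V.orthogonalProjectionOnto x) ≤ ‖u‖ * R :=
    (real_inner_le_norm _ _).trans (by
      gcongr
      exact (V.norm_orthogonalProjectionOnto_apply_le x).trans hx)
  have h5 : C * ‖x - V.orthogonalProjectionOnto x‖ ≤ C * δ := by gcongr
  have hmain := mul_le_mul_of_nonneg_left (norm_sub_le_inner_normalize u w) hR0
  have h6 : R * (2 * ‖u - w‖) ≤ 2 * (√(Fintype.card ι) * η) := by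
    nlinarith [norm_nonneg (u - w)]
  rw [hf]
  linarith

theorem norm_mul_inv_norm_smul_le {E : Type*} [NormedAddCommGroup E] [NormedSpace ℝ E] {R : ℝ}
    (hR : 0 ≤ R) (w : E) : ‖(R * ‖w‖⁻¹) • w‖ ≤ R := by
  rw [norm_smul, norm_mul, norm_inv, norm_norm, Real.norm_of_nonneg hR, mul_assoc]
  exact mul_le_of_le_one_right hR inv_mul_le_one

/-- A class close to a finite-dimensional subspace of `L²` is learned with one query for each
dimension. -/
theorem agnosticallySQLearnable_of_finiteDimensional {H : Set (Rn n → ℝ)} {ε δ τ B : ℝ}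
    (hC : 0 ≤ C) (hB : 0 < B) (hτ : 0 ≤ τ) (hmem : ∀ h ∈ H, MemLp h 2 (stdGaussian (Rn n)))
    (hsymm : ∀ h ∈ H, -h ∈ H) (hnorm : ∀ h ∈ H, eLpNorm h 2 (stdGaussian (Rn n)) ≤ 1)
    (V : Submodule ℝ (Lp ℝ 2 (stdGaussian (Rn n)))) [FiniteDimensional ℝ V]
    (happrox : ∀ (h : Rn n → ℝ) (hh : h ∈ H), ∃ g ∈ V, ‖(hmem h hh).toLp h - g‖ ≤ δ)
    (herr : 2 * (√(Module.finrank ℝ V) * (B * τ + C ^ 2 / B)) + C * δ ≤ ε) :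
    AgnosticallySQLearnable H C ε (Module.finrank ℝ V) τ := by
  obtain ⟨R, hR⟩ : ∃ R, R = (gaussianDiam H / 2).toReal := ⟨_, rfl⟩
  have hdiam : gaussianDiam H / 2 ≤ 1 := by
    rw [ENNReal.div_le_iff_le_mul (by simp) (by simp), one_mul]
    exact gaussianDiam_le_two hmem hnorm
  have hdiam' : gaussianDiam H / 2 ≠ ∞ := ne_top_of_le_ne_top ENNReal.one_ne_top hdiam
  have hR0 : 0 ≤ R := hR ▸ ENNReal.toReal_nonneg
  have hR1 : R ≤ 1 := by
    rw [hR]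
    exact ENNReal.toReal_le_of_le_ofReal zero_le_one (by simpa using hdiam)
  have hRnorm : ∀ (h : Rn n → ℝ) (hh : h ∈ H), ‖(hmem h hh).toLp h‖ ≤ R := by
    intro h hh
    rw [Lp.norm_toLp, hR]
    exact ENNReal.toReal_mono hdiam' (eLpNorm_le_half_gaussianDiam hsymm hh)
  obtain ⟨b⟩ : Nonempty (OrthonormalBasis (Fin (Module.finrank ℝ V)) ℝ V) :=
    ⟨stdOrthonormalBasis ℝ V⟩
  have hbm : ∀ i, Measurable (b i : Lp ℝ 2 (stdGaussian (Rn n))) :=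
    fun i => (Lp.stronglyMeasurable _).measurable
  have hb1 : ∀ i, ∫ x, (b i : Lp ℝ 2 (stdGaussian (Rn n))) x *
      (b i : Lp ℝ 2 (stdGaussian (Rn n))) x ∂(stdGaussian (Rn n)) = 1 := by
    intro i
    rw [← inner_toLp_toLp (Lp.memLp _) (Lp.memLp _), Lp.toLp_coeFn, real_inner_self_eq_norm_sq]
    have : ‖(b i : Lp ℝ 2 (stdGaussian (Rn n)))‖ = 1 := b.orthonormal.1 i
    rw [this, one_pow]
  -- Queries are normalized by B, so the answers are multiplied back; this turns the tolerance into
  -- Bτ, against a clipping bias C²/B.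
  obtain ⟨L, hL1, hL2⟩ := SQLearner.exists_nonadaptive (Module.finrank ℝ V)
    (fun i => clipQuery _ (hbm i) B) (fun v =>
      ((R * ‖∑ i, (B * v i) • b i‖⁻¹) • ∑ i, (B * v i) • b i : V).1)
  refine ⟨L, hL1, fun 𝒟 h𝒟 => hL2 𝒟 τ _ fun v hv => ?_⟩
  obtain ⟨ℓ, hℓ, hℓC⟩ := h𝒟.exists_correlation_functional hC
  have hℓ' : ∀ g : Lp ℝ 2 (stdGaussian (Rn n)), correlation 𝒟 g = ℓ g := by
    intro g
    rw [hℓ g (Lp.memLp g), Lp.toLp_coeFn]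
  have hη : ∀ i, |ℓ (b i) - B * v i| ≤ B * τ + C ^ 2 / B := by
    intro i
    have h1 := h𝒟.abs_correlation_sub_clipQuery_le (hbm i) (Lp.memLp _) (hb1 i) hB
    have h2 := hv i
    rw [hℓ'] at h1
    set I := ∫ z, (clipQuery _ (hbm i) B).toFun z ∂𝒟
    have h3 : |B * I - B * v i| ≤ B * τ := by
      rw [← mul_sub, abs_mul, abs_of_pos hB, abs_sub_comm]
      gcongr
    calc |ℓ (b i) - B * v i| = |(ℓ (b i) - B * I) + (B * I - B * v i)| := by congr 1; ring
      _ ≤ _ := (abs_add_le _ _).trans (by linarith)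
  refine ⟨Lp.memLp _, ?_, fun h hh => ?_⟩
  · have h1 := norm_mul_inv_norm_smul_le hR0 (∑ i, (B * v i) • b i)
    generalize (R * ‖∑ i, (B * v i) • b i‖⁻¹) • ∑ i, (B * v i) • b i = z at h1 ⊢
    rw [Submodule.coe_norm, Lp.norm_def, hR] at h1
    rwa [← ENNReal.toReal_le_toReal (Lp.eLpNorm_ne_top _) hdiam']
  · obtain ⟨g, hg, hgδ⟩ := happrox h hh
    have key := sub_le_apply_normalize b hC hℓC (by positivity) hη hR0 hR1 (hRnorm h hh) hg hgδ
    rw [Fintype.card_fin] at key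
    rw [hℓ h (hmem h hh), hℓ']
    linarith

end Learner

/-! ### Reduction of units to one-variable polynomial approximation -/

section UnitClass

open Polynomial

variable {n : ℕ}

theorem measurePreserving_inner_stdGaussian {u : Rn n} (hu : ‖u‖ = 1) :
    MeasurePreserving (fun x => inner ℝ u x) (stdGaussian (Rn n)) (gaussianReal 0 1) := by
  refine ⟨by fun_prop, ?_⟩
  have h := IsGaussian.map_eq_gaussianReal (μ := stdGaussian (Rn n)) (innerSL ℝ u)
  rw [integral_strongDual_stdGaussian, variance_dual_stdGaussian, innerSL_apply_norm, hu] at h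
  simpa using h

theorem memLp_one_add_norm_pow {E : Type*} [NormedAddCommGroup E] [NormedSpace ℝ E]
    [MeasurableSpace E] [BorelSpace E] [SecondCountableTopology E] [CompleteSpace E]
    (μ : Measure E) [IsGaussian μ] (d : ℕ) : MemLp (fun x : E => (1 + ‖x‖) ^ d) 2 μ := by
  rcases Nat.eq_zero_or_pos d with rfl | hd
  · simpa using memLp_const (1 : ℝ)
  · have hid : MemLp (fun x : E => x) (2 * d) μ := IsGaussian.memLp_id μ _
      (ENNReal.mul_ne_top ENNReal.ofNat_ne_top (ENNReal.natCast_ne_top d))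
    have h1 : MemLp (fun x : E => 1 + ‖x‖) (2 * d) μ := (memLp_const (1 : ℝ)).add hid.norm
    have h2 := h1.norm_rpow_div (d : ℝ≥0∞)
    rw [ENNReal.mul_div_cancel_right (by exact_mod_cast hd.ne') (ENNReal.natCast_ne_top d)] at h2
    refine h2.ae_eq (ae_of_all _ fun x => ?_)
    simp only [ENNReal.toReal_natCast, Real.rpow_natCast]
    rw [Real.norm_of_nonneg (by positivity)]

/-- The product of `d` coordinates of `x`, where `none` stands for the constant `1`. -/
def monomialFun {d : ℕ} (s : Fin d → Option (Fin n)) (x : Rn n) : ℝ :=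
  ∏ j, (s j).elim 1 fun i => x i

theorem memLp_monomialFun {d : ℕ} (s : Fin d → Option (Fin n)) :
    MemLp (monomialFun s) 2 (stdGaussian (Rn n)) := by
  have hmeas : Measurable (monomialFun s) := by
    unfold monomialFun
    refine Finset.measurable_prod _ fun j _ => ?_
    rcases s j with _ | i
    · exact measurable_const
    · simp only [Option.elim_some]
      fun_prop
  have hbound := memLp_one_add_norm_pow (stdGaussian (Rn n)) d
  refine hbound.mono hmeas.aestronglyMeasurable (ae_of_all _ fun x => ?_)
  rw [Real.norm_of_nonneg (by positivity : 0 ≤ (1 + ‖x‖) ^ d), monomialFun, norm_prod]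
  calc ∏ j, ‖((s j).elim 1 fun i => x i : ℝ)‖ ≤ ∏ _j : Fin d, (1 + ‖x‖) := by
        refine Finset.prod_le_prod (fun _ _ => norm_nonneg _) fun j _ => ?_
        rcases s j with _ | i
        · simp
        · have := PiLp.norm_apply_le x i
          simp only [Option.elim_some]
          linarith
    _ = (1 + ‖x‖) ^ d := by simp

/-- The space of polynomials of total degree at most `d` in `L²` of the standard Gaussian. -/
noncomputable def polySpan (n d : ℕ) : Submodule ℝ (Lp ℝ 2 (stdGaussian (Rn n))) :=
  Submodule.span ℝ (Set.range fun s : Fin d → Option (Fin n) =>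
    (memLp_monomialFun s).toLp (monomialFun s))

instance finiteDimensional_polySpan (n d : ℕ) : FiniteDimensional ℝ (polySpan n d) :=
  FiniteDimensional.span_of_finite ℝ (Set.finite_range _)

theorem finrank_polySpan_le (n d : ℕ) : Module.finrank ℝ (polySpan n d) ≤ (n + 1) ^ d := by
  refine (finrank_range_le_card _).trans ?_
  simp

/-- The functions whose class in `L²` lies in `V`. -/
def functionsOf {α : Type*} [MeasurableSpace α] {μ : Measure α} (V : Submodule ℝ (Lp ℝ 2 μ)) :
    Submodule ℝ (α → ℝ) where
  carrier := {f | ∃ hf : MemLp f 2 μ, hf.toLp f ∈ V}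
  zero_mem' := ⟨MemLp.zero, by simp [V.zero_mem]⟩
  add_mem' := by
    rintro f g ⟨hf, hfV⟩ ⟨hg, hgV⟩
    exact ⟨hf.add hg, by rw [MemLp.toLp_add hf hg]; exact V.add_mem hfV hgV⟩
  smul_mem' := by
    rintro c f ⟨hf, hfV⟩
    exact ⟨hf.const_smul c, by rw [MemLp.toLp_const_smul c hf]; exact V.smul_mem c hfV⟩

/-- Write the power as a product of d factors, k of them ⟨u, x⟩ and the rest 1, and expand over
choices of a coordinate or 1 in each factor. -/
theorem inner_pow_mem_functionsOf (u : Rn n) {d k : ℕ} (hk : k ≤ d) :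
    (fun x => (inner ℝ u x) ^ k) ∈ functionsOf (polySpan n d) := by
  classical
  let a : Fin d → Option (Fin n) → ℝ := fun j o =>
    if (j : ℕ) < k then o.elim 0 (fun i => u i) else o.elim 1 (fun _ => 0)
  have hfac : ∀ (x : Rn n) (j : Fin d), ∑ o, a j o * o.elim 1 (fun i => x i) =
      if (j : ℕ) < k then inner ℝ u x else 1 := by
    intro x j
    rw [Fintype.sum_option]
    by_cases hj : (j : ℕ) < k
    · simp [a, hj, PiLp.inner_apply, mul_comm]
    · simp [a, hj]
  have hprod : (fun x => (inner ℝ u x : ℝ) ^ k) =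
      ∑ s : Fin d → Option (Fin n), (∏ j, a j (s j)) • monomialFun s := by
    ext x
    have h1 : ∏ j : Fin d, (if (j : ℕ) < k then inner ℝ u x else (1 : ℝ)) = (inner ℝ u x) ^ k := by
      rw [Finset.prod_ite, Finset.prod_const_one, mul_one, Finset.prod_const]
      congr 1
      rw [Fin.card_filter_val_lt, min_eq_right hk]
    rw [← h1]
    simp_rw [← hfac x]
    rw [Finset.prod_univ_sum, Fintype.piFinset_univ, Finset.sum_apply]
    refine Finset.sum_congr rfl fun s _ => ?_
    rw [Finset.prod_mul_distrib]
    rfl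
  rw [hprod]
  exact Submodule.sum_mem _ fun s _ => Submodule.smul_mem _ _
    ⟨memLp_monomialFun s, Submodule.subset_span ⟨s, rfl⟩⟩

theorem eval_inner_mem_functionsOf (u : Rn n) {d : ℕ} {p : ℝ[X]} (hp : p.natDegree ≤ d) :
    (fun x => p.eval (inner ℝ u x)) ∈ functionsOf (polySpan n d) := by
  have h : (fun x => p.eval (inner ℝ u x)) = ∑ k ∈ Finset.range (p.natDegree + 1),
      p.coeff k • fun x : Rn n => (inner ℝ u x : ℝ) ^ k := by
    ext x
    rw [eval_eq_sum_range]
    simp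
  rw [h]
  refine Submodule.sum_mem _ fun k hk => Submodule.smul_mem _ _ (inner_pow_mem_functionsOf u ?_)
  have := Finset.mem_range.1 hk
  omega

theorem exists_unit_smul [NeZero n] (w : Rn n) : ∃ u : Rn n, ‖u‖ = 1 ∧ w = ‖w‖ • u := by
  rcases eq_or_ne w 0 with rfl | hw
  · exact ⟨EuclideanSpace.single 0 1, by simp, by simp⟩
  · refine ⟨‖w‖⁻¹ • w, norm_smul_inv_norm hw, ?_⟩
    rw [smul_smul, mul_inv_cancel₀ (norm_ne_zero_iff.2 hw), one_smul]

theorem neg_mem_unitClass {φ : ℝ → ℝ} {h : Rn n → ℝ} (hh : h ∈ unitClass φ n) :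
    -h ∈ unitClass φ n := by
  obtain ⟨w, hw, rfl | rfl⟩ := hh
  · exact ⟨w, hw, Or.inr rfl⟩
  · exact ⟨w, hw, Or.inl (by ext x; simp)⟩

/-- Moving ρ = ‖w‖ into the profile leaves a unit direction, along which the marginal is standard
normal. -/
theorem exists_of_mem_unitClass [NeZero n] {φ : ℝ → ℝ} {h : Rn n → ℝ} (hh : h ∈ unitClass φ n) :
    ∃ u : Rn n, ‖u‖ = 1 ∧ ∃ ρ : ℝ, 0 ≤ ρ ∧ ρ ≤ 1 ∧ ∃ σ : ℝ, |σ| = 1 ∧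
      h = σ • ((fun t => φ (ρ * t)) ∘ fun x => inner ℝ u x) := by
  obtain ⟨w, hw, hh⟩ := hh
  obtain ⟨u, hu, hwu⟩ := exists_unit_smul w
  have e : ∀ x, inner ℝ w x = ‖w‖ * inner ℝ u x := by
    intro x
    conv_lhs => rw [hwu]
    rw [real_inner_smul_left]
  rcases hh with rfl | rfl
  · exact ⟨u, hu, ‖w‖, norm_nonneg w, hw, 1, by simp, by ext x; simp [e]⟩
  · exact ⟨u, hu, ‖w‖, norm_nonneg w, hw, -1, by simp, by ext x; simp [e]⟩

variable {φ : ℝ → ℝ}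

theorem memLp_of_mem_unitClass [NeZero n]
    (hmem : ∀ ρ, 0 ≤ ρ → ρ ≤ 1 → MemLp (fun t => φ (ρ * t)) 2 (gaussianReal 0 1))
    {h : Rn n → ℝ} (hh : h ∈ unitClass φ n) : MemLp h 2 (stdGaussian (Rn n)) := by
  obtain ⟨u, hu, ρ, h0, h1, σ, -, rfl⟩ := exists_of_mem_unitClass hh
  exact ((hmem ρ h0 h1).comp_measurePreserving (measurePreserving_inner_stdGaussian hu)).const_smul σ

theorem eLpNorm_le_one_of_mem_unitClass [NeZero n]
    (hmem : ∀ ρ, 0 ≤ ρ → ρ ≤ 1 → MemLp (fun t => φ (ρ * t)) 2 (gaussianReal 0 1))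
    (hnorm : ∀ ρ, 0 ≤ ρ → ρ ≤ 1 → eLpNorm (fun t => φ (ρ * t)) 2 (gaussianReal 0 1) ≤ 1)
    {h : Rn n → ℝ} (hh : h ∈ unitClass φ n) : eLpNorm h 2 (stdGaussian (Rn n)) ≤ 1 := by
  obtain ⟨u, hu, ρ, h0, h1, σ, hσ, rfl⟩ := exists_of_mem_unitClass hh
  have hσ' : ‖σ‖ₑ = 1 := by rw [Real.enorm_eq_ofReal_abs, hσ, ENNReal.ofReal_one]
  rw [eLpNorm_const_smul, hσ', one_mul,
    eLpNorm_comp_measurePreserving (hmem ρ h0 h1).1 (measurePreserving_inner_stdGaussian hu)]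
  exact hnorm ρ h0 h1

theorem exists_mem_polySpan_of_mem_unitClass [NeZero n] {d : ℕ} {δ : ℝ} (hδ : 0 ≤ δ)
    (hmem : ∀ ρ, 0 ≤ ρ → ρ ≤ 1 → MemLp (fun t => φ (ρ * t)) 2 (gaussianReal 0 1))
    (happrox : ∀ ρ, 0 ≤ ρ → ρ ≤ 1 → ∃ p : ℝ[X], p.natDegree ≤ d ∧
      eLpNorm (fun t => φ (ρ * t) - p.eval t) 2 (gaussianReal 0 1) ≤ ENNReal.ofReal δ)
    {h : Rn n → ℝ} (hh : h ∈ unitClass φ n) (hhm : MemLp h 2 (stdGaussian (Rn n))) :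
    ∃ g ∈ polySpan n d, ‖hhm.toLp h - g‖ ≤ δ := by
  obtain ⟨u, hu, ρ, h0, h1, σ, hσ, rfl⟩ := exists_of_mem_unitClass hh
  have hσ' : ‖σ‖ₑ = 1 := by rw [Real.enorm_eq_ofReal_abs, hσ, ENNReal.ofReal_one]
  obtain ⟨p, hp, hpδ⟩ := happrox ρ h0 h1
  obtain ⟨hg, hgV⟩ := Submodule.smul_mem _ σ (eval_inner_mem_functionsOf u hp)
  refine ⟨_, hgV, ?_⟩
  have e : (σ • ((fun t => φ (ρ * t)) ∘ fun x => inner ℝ u x)) -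
      (σ • fun x : Rn n => p.eval (inner ℝ u x)) =
      σ • ((fun t => φ (ρ * t) - p.eval t) ∘ fun x => inner ℝ u x) := by
    ext x
    simp
    ring
  rw [← MemLp.toLp_sub, Lp.norm_toLp]
  refine ENNReal.toReal_le_of_le_ofReal hδ ?_
  have hm : MemLp (fun t => φ (ρ * t) - p.eval t) 2 (gaussianReal 0 1) :=
    (hmem ρ h0 h1).sub (memLp_eval_gaussianReal p)
  rw [e, eLpNorm_const_smul, hσ', one_mul, eLpNorm_comp_measurePreserving hm.1
    (measurePreserving_inner_stdGaussian hu)]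
  exact hpδ

/-- If the activation is approximated by polynomials of degree `d`, then the class of units is
learned with `(n + 1) ^ d` queries. -/
theorem exists_agnosticallySQLearnable_unitClass (hn : 1 ≤ n) {C ε τ : ℝ} {d : ℕ} (hC : 0 < C)
    (hε : 0 < ε) (hτ : 0 ≤ τ)
    (hmem : ∀ ρ, 0 ≤ ρ → ρ ≤ 1 → MemLp (fun t => φ (ρ * t)) 2 (gaussianReal 0 1))
    (hnorm : ∀ ρ, 0 ≤ ρ → ρ ≤ 1 → eLpNorm (fun t => φ (ρ * t)) 2 (gaussianReal 0 1) ≤ 1)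
    (happrox : ∀ ρ, 0 ≤ ρ → ρ ≤ 1 → ∃ p : ℝ[X], p.natDegree ≤ d ∧
      eLpNorm (fun t => φ (ρ * t) - p.eval t) 2 (gaussianReal 0 1) ≤ ENNReal.ofReal (ε / (2 * C)))
    {A : ℝ} (hA : ((n : ℝ) + 1) ^ d ≤ A) (hτA : τ * (64 * C ^ 2 * A ^ 2) ≤ ε ^ 2) :
    ∃ q : ℕ, (q : ℝ) ≤ A ∧ AgnosticallySQLearnable (unitClass φ n) C ε q τ := by
  have : NeZero n := ⟨by omega⟩
  have hq : (Module.finrank ℝ (polySpan n d) : ℝ) ≤ A := by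
    refine le_trans ?_ hA
    exact_mod_cast finrank_polySpan_le n d
  have hA1 : 1 ≤ A := (one_le_pow₀ (by linarith [(Nat.cast_nonneg n : (0 : ℝ) ≤ n)])).trans hA
  -- B makes the bias term A C²/B equal to ε/8, and `hτA` bounds A B τ by ε/8. Doubling their sum
  -- and adding Cδ = ε/2 gives ε.
  refine ⟨_, hq, agnosticallySQLearnable_of_finiteDimensional (δ := ε / (2 * C))
    (B := 8 * A * C ^ 2 / ε) hC.le (by positivity) hτ
    (fun h hh => memLp_of_mem_unitClass hmem hh) (fun h hh => neg_mem_unitClass hh)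
    (fun h hh => eLpNorm_le_one_of_mem_unitClass hmem hnorm hh) (polySpan n d)
    (fun h hh => exists_mem_polySpan_of_mem_unitClass (by positivity) hmem happrox hh _) ?_⟩
  have hsqrt : √(Module.finrank ℝ (polySpan n d)) ≤ A :=
    (Real.sqrt_le_sqrt hq).trans ((Real.sqrt_le_left (by linarith)).2 (by nlinarith))
  have h1 : A * (8 * A * C ^ 2 / ε * τ) ≤ ε / 8 := by
    rw [show A * (8 * A * C ^ 2 / ε * τ) = τ * (64 * C ^ 2 * A ^ 2) / (8 * ε) by field_simp; ring,
      div_le_iff₀ (by positivity)]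
    nlinarith
  have h2 : A * (C ^ 2 / (8 * A * C ^ 2 / ε)) = ε / 8 := by
    field_simp
  have h3 : C * (ε / (2 * C)) = ε / 2 := by
    field_simp
  have h4 : √(Module.finrank ℝ (polySpan n d)) *
      (8 * A * C ^ 2 / ε * τ + C ^ 2 / (8 * A * C ^ 2 / ε)) ≤
      A * (8 * A * C ^ 2 / ε * τ + C ^ 2 / (8 * A * C ^ 2 / ε)) := by
    gcongr
  rw [mul_add A] at h4
  linarith

end UnitClass

/-! ### Choice of degree, exponents and tolerance -/

section Main

open Polynomial

theorem eLpNorm_relu_mul_le_one {ρ : ℝ} (h0 : 0 ≤ ρ) (h1 : ρ ≤ 1) :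
    eLpNorm (fun t => relu (ρ * t)) 2 (gaussianReal 0 1) ≤ 1 := by
  have hX : MemLp (fun t : ℝ => t) 2 (gaussianReal 0 1) := by
    simpa using memLp_eval_gaussianReal X
  have hint : ∫ t, t * t ∂(gaussianReal 0 1) = 1 := by
    simpa [hermiteReal] using integral_hermiteReal_mul_self 1
  have hone : eLpNorm (fun t : ℝ => t) 2 (gaussianReal 0 1) ≤ 1 := by
    rw [← inner_toLp_toLp hX hX, real_inner_self_eq_norm_sq,
      pow_eq_one_iff_of_nonneg (norm_nonneg _) two_ne_zero, Lp.norm_toLp,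
      ENNReal.toReal_eq_one_iff] at hint
    exact hint.le
  refine (eLpNorm_mono fun t => ?_).trans hone
  refine (abs_relu_le _).trans ?_
  rw [abs_mul, abs_of_nonneg h0]
  exact mul_le_of_le_one_left (abs_nonneg t) h1

theorem relu_mul {ρ : ℝ} (h0 : 0 ≤ ρ) (t : ℝ) : relu (ρ * t) = ρ * relu t := by
  rw [relu, relu, mul_max_of_nonneg _ _ h0, mul_zero]

theorem memLp_relu_mul {ρ : ℝ} (h0 : 0 ≤ ρ) :
    MemLp (fun t => relu (ρ * t)) 2 (gaussianReal 0 1) := by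
  simp_rw [relu_mul h0]
  exact memLp_relu.const_mul ρ

theorem exists_polynomial_relu_mul {d : ℕ} (hd : 1 ≤ d) {δ : ℝ} (hδ : 0 ≤ δ)
    (h : 1 / (d * √d) ≤ δ ^ 2) {ρ : ℝ} (h0 : 0 ≤ ρ) (h1 : ρ ≤ 1) :
    ∃ p : ℝ[X], p.natDegree ≤ d ∧
      eLpNorm (fun t => relu (ρ * t) - p.eval t) 2 (gaussianReal 0 1) ≤ ENNReal.ofReal δ := by
  obtain ⟨p, hp, hpδ⟩ := exists_polynomial_relu hd hδ h
  refine ⟨C ρ * p, (natDegree_C_mul_le _ _).trans hp, (eLpNorm_mono fun t => ?_).trans hpδ⟩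
  rw [relu_mul h0, eval_mul, eval_C, ← mul_sub, norm_mul, Real.norm_of_nonneg h0]
  exact mul_le_of_le_one_left (norm_nonneg _) h1

theorem eLpNorm_sigmoid_mul_le_one (ρ : ℝ) :
    eLpNorm (fun t => Real.sigmoid (ρ * t)) 2 (gaussianReal 0 1) ≤ 1 := by
  refine (eLpNorm_le_of_ae_bound (C := 1) (ae_of_all _ fun t => ?_)).trans ?_
  · rw [Real.norm_of_nonneg (Real.sigmoid_nonneg _)]
    exact Real.sigmoid_le_one _
  · simp

/-- When `ε ≥ C`, the zero hypothesis is good enough. -/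
theorem agnosticallySQLearnable_relu_of_le {n : ℕ} (hn : 1 ≤ n) {C ε τ : ℝ} (hC : 0 < C)
    (hε : C ≤ ε) (hτ : 0 ≤ τ) : AgnosticallySQLearnable (unitClass relu n) C ε 0 τ := by
  have : NeZero n := ⟨by omega⟩
  have hmem : ∀ ρ : ℝ, 0 ≤ ρ → ρ ≤ 1 → MemLp (fun t => relu (ρ * t)) 2 (gaussianReal 0 1) :=
    fun ρ h0 _ => memLp_relu_mul h0
  have hnorm : ∀ h ∈ unitClass relu n, eLpNorm h 2 (stdGaussian (Rn n)) ≤ 1 := fun h hh =>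
    eLpNorm_le_one_of_mem_unitClass hmem (fun ρ => eLpNorm_relu_mul_le_one) hh
  -- V = 0 approximates within 1, with no queries and error C.
  have key := agnosticallySQLearnable_of_finiteDimensional (n := n) (ε := ε) (δ := 1) (B := 1)
    hC.le one_pos hτ (fun h hh => memLp_of_mem_unitClass hmem hh)
    (fun h hh => neg_mem_unitClass hh) hnorm ⊥ (fun h hh => ⟨0, Submodule.zero_mem _, ?_⟩) ?_
  · rwa [finrank_bot] at key
  · rw [sub_zero, Lp.norm_toLp]
    exact ENNReal.toReal_le_of_le_ofReal zero_le_one (by simpa using hnorm h hh)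
  · rw [finrank_bot]
    simpa using hε

theorem half_le_natCast_rpow {n : ℕ} (hn : 2 ≤ n) {y : ℝ} (hy : 0 ≤ y) :
    y / 2 ≤ (n : ℝ) ^ y := by
  have hn' : (2 : ℝ) ≤ n := by exact_mod_cast hn
  calc y / 2 ≤ y * Real.log 2 := by nlinarith [Real.log_two_gt_d9]
    _ ≤ Real.exp (y * Real.log 2) := by linarith [Real.add_one_le_exp (y * Real.log 2)]
    _ = 2 ^ y := by rw [Real.rpow_def_of_pos two_pos, mul_comm]
    _ ≤ (n : ℝ) ^ y := by gcongr

/-- The factor 2 pays for n + 1 ≤ n². -/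
theorem add_one_pow_le_rpow {n : ℕ} (hn : 2 ≤ n) {d : ℕ} {y : ℝ} (hd : 2 * (d : ℝ) ≤ y) :
    ((n : ℝ) + 1) ^ d ≤ (n : ℝ) ^ y := by
  have hn' : (2 : ℝ) ≤ n := by exact_mod_cast hn
  calc ((n : ℝ) + 1) ^ d ≤ ((n : ℝ) ^ 2) ^ d := by
        gcongr
        nlinarith
    _ = (n : ℝ) ^ (2 * (d : ℝ)) := by
        rw [← pow_mul, ← Real.rpow_natCast]
        push_cast
        rfl
    _ ≤ (n : ℝ) ^ y := Real.rpow_le_rpow_of_exponent_le (by linarith) hd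

/-- The tolerance `n ^ (-(2 K + c) x)` absorbs both the square of the number of queries and the
factor `c x / 2`. -/
theorem rpow_neg_mul_sq_le {n : ℕ} (hn : 2 ≤ n) {K c x : ℝ} (hc : 0 < c) (hx : 0 < x) :
    (n : ℝ) ^ (-((2 * K + c) * x)) * ((n : ℝ) ^ (K * x)) ^ 2 ≤ 2 / (c * x) := by
  have hn' : (0 : ℝ) < n := by exact_mod_cast (by omega : 0 < n)
  have h := half_le_natCast_rpow hn (mul_pos hc hx).le
  rw [← Real.rpow_natCast, ← Real.rpow_mul hn'.le, ← Real.rpow_add hn',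
    show -((2 * K + c) * x) + K * x * (2 : ℕ) = -(c * x) by push_cast; ring,
    Real.rpow_neg hn'.le, ← one_div, one_div_le (by positivity) (by positivity), one_div_div]
  exact h

theorem relu_learnable {C : ℝ} (hC : 0 < C) :
    ∃ K c : ℝ, 0 < K ∧ 0 < c ∧
      ∀ n : ℕ, 2 ≤ n → ∀ ε : ℝ, 0 < ε →
        ∃ q : ℕ, (q : ℝ) ≤ (n : ℝ) ^ (K * ε ^ (-(4 / 3) : ℝ)) ∧
          AgnosticallySQLearnable (unitClass relu n) C ε q
            ((n : ℝ) ^ (-(c * ε ^ (-(4 / 3) : ℝ))) * ε) := by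
  -- With y = (2C/ε)^(4/3) ≥ 1 and d = ⌈y⌉, 2d ≤ 4y = K ε^(-4/3).
  set K : ℝ := 4 * (2 * C) ^ (4 / 3 : ℝ) with hK
  set c : ℝ := 128 * C ^ (7 / 3 : ℝ) with hc
  have hKpos : 0 < K := by positivity
  have hcpos : 0 < c := by positivity
  refine ⟨K, 2 * K + c, hKpos, by positivity, fun n hn ε hε => ?_⟩
  rcases le_or_gt C ε with hCε | hCε
  · exact ⟨0, by simp; positivity, agnosticallySQLearnable_relu_of_le (by omega) hC hCε
      (by positivity)⟩
  set x : ℝ := ε ^ (-(4 / 3) : ℝ) with hx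
  have hxpos : 0 < x := by positivity
  set y : ℝ := (2 * C / ε) ^ (4 / 3 : ℝ) with hy
  have hyx : 4 * y = K * x := by
    rw [hy, hK, hx, Real.div_rpow (by positivity) hε.le, Real.rpow_neg hε.le]
    ring
  have hy1 : 1 ≤ y := Real.one_le_rpow (by rw [le_div_iff₀ hε]; linarith) (by norm_num)
  set d : ℕ := ⌈y⌉₊ with hd
  have hyd : y ≤ d := Nat.le_ceil y
  have hd1 : 1 ≤ d := Nat.one_le_ceil_iff.2 (by linarith)
  have hdy : 2 * (d : ℝ) ≤ K * x := by
    have := Nat.ceil_lt_add_one (by linarith : 0 ≤ y)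
    linarith
  have hδ : 1 / (d * √d) ≤ (ε / (2 * C)) ^ 2 := by
    have h1 : (2 * C / ε) ^ 2 = y * √y := by
      rw [Real.sqrt_eq_rpow, hy, ← Real.rpow_mul (by positivity), ← Real.rpow_add (by positivity),
        ← Real.rpow_natCast]
      norm_num
    rw [← one_div_div (2 * C) ε, div_pow, one_pow, h1]
    gcongr
  refine exists_agnosticallySQLearnable_unitClass (by omega) hC hε (by positivity)
    (fun ρ h0 _ => memLp_relu_mul h0) (fun ρ => eLpNorm_relu_mul_le_one)
    (fun ρ => exists_polynomial_relu_mul hd1 (by positivity) hδ) (add_one_pow_le_rpow hn hdy) ?_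
  -- Recovers the missing factor ε of the tolerance: εx = ε^(-1/3) > C^(-1/3), because ε < C in this
  -- branch.
  have h2 : 64 * C ^ 2 * 2 ≤ ε * (c * x) := by
    have h3 : ε * x = ε ^ (-(1 / 3) : ℝ) := by
      rw [hx]
      nth_rewrite 1 [← Real.rpow_one ε]
      rw [← Real.rpow_add hε]
      norm_num
    have h4 : C ^ (-(1 / 3) : ℝ) ≤ ε ^ (-(1 / 3) : ℝ) :=
      Real.rpow_le_rpow_of_nonpos hε hCε.le (by norm_num)
    have h5 : C ^ (7 / 3 : ℝ) * C ^ (-(1 / 3) : ℝ) = C ^ 2 := by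
      rw [← Real.rpow_add hC, ← Real.rpow_natCast]
      norm_num
    calc 64 * C ^ 2 * 2 = c * C ^ (-(1 / 3) : ℝ) := by rw [← h5, hc]; ring
      _ ≤ c * (ε * x) := by rw [h3]; gcongr
      _ = ε * (c * x) := by ring
  have h6 := rpow_neg_mul_sq_le (K := K) hn hcpos hxpos
  calc (n : ℝ) ^ (-((2 * K + c) * x)) * ε * (64 * C ^ 2 * ((n : ℝ) ^ (K * x)) ^ 2)
      = ε * (64 * C ^ 2) * ((n : ℝ) ^ (-((2 * K + c) * x)) * ((n : ℝ) ^ (K * x)) ^ 2) := by ring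
    _ ≤ ε * (64 * C ^ 2) * (2 / (c * x)) := by gcongr
    _ = ε * (64 * C ^ 2 * 2 / (c * x)) := by ring
    _ ≤ ε * ε := by
      gcongr
      rwa [div_le_iff₀ (by positivity)]
    _ = ε ^ 2 := by ring

theorem sigmoid_learnable {C : ℝ} (hC : 0 < C) :
    ∃ K c : ℝ, ∃ k l : ℕ, 0 < K ∧ 0 < c ∧
      ∀ n : ℕ, 2 ≤ n → ∀ ε : ℝ, 0 < ε → ε ≤ 1 / 2 →
        ∃ q : ℕ, (q : ℝ) ≤ (n : ℝ) ^ (K * softLogSq k ε) ∧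
          AgnosticallySQLearnable (unitClass Real.sigmoid n) C ε q
            ((n : ℝ) ^ (-(c * softLogSq l ε)) * ε ^ 2) := by
  -- As L ≥ 1/2, m ≤ 2|log(2C)| + 2L + 1 ≤ κL. Then K = 2·17κ² covers twice the degree, and c gives
  -- cL² ≥ 128C².
  set κ : ℝ := 4 * |Real.log (2 * C)| + 4 with hκ
  have hκpos : 0 < κ := by positivity
  set K : ℝ := 34 * κ ^ 2 with hK
  set c : ℝ := 512 * C ^ 2 with hc
  have hKpos : 0 < K := by positivity
  have hcpos : 0 < c := by positivity
  -- No iterated logarithm is lost, so k = l = 0.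
  refine ⟨K, 2 * K + c, 0, 0, hKpos, by positivity, fun n hn ε hε hε2 => ?_⟩
  set L : ℝ := Real.log (1 / ε) with hL
  have hs : softLogSq 0 ε = L ^ 2 := by simp [softLogSq, hL]
  rw [hs]
  have hL2 : 1 / 2 ≤ L := by
    have : Real.log 2 ≤ L := Real.log_le_log two_pos (by rw [le_div_iff₀ hε]; linarith)
    linarith [Real.log_two_gt_d9]
  -- The 2 compensates log 2 ≥ 1/2, so that 2^m ≥ 2C/ε.
  set m : ℕ := ⌈2 * (|Real.log (2 * C)| + L)⌉₊ with hm
  have habs := abs_nonneg (Real.log (2 * C))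
  have hm1 : 1 ≤ m := Nat.one_le_ceil_iff.2 (by linarith)
  have hm2 : 2 * (|Real.log (2 * C)| + L) ≤ m := Nat.le_ceil _
  have hm3 : (m : ℝ) ≤ κ * L := by
    have := Nat.ceil_lt_add_one (by linarith : 0 ≤ 2 * (|Real.log (2 * C)| + L))
    nlinarith
  have hδ : (1 / 2 : ℝ) ^ m ≤ ε / (2 * C) := by
    have h1 : 2 * C / ε ≤ 2 ^ m := by
      rw [← Real.log_le_log_iff (by positivity) (by positivity), Real.log_pow,
        div_eq_mul_one_div, Real.log_mul (by positivity) (by positivity)]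
      have := le_abs_self (Real.log (2 * C))
      nlinarith [Real.log_two_gt_d9]
    rw [one_div_pow, ← one_div_div (2 * C) ε]
    gcongr
  have hd : 2 * ((17 * m ^ 2 : ℕ) : ℝ) ≤ K * L ^ 2 := by
    push_cast
    have : (m : ℝ) ^ 2 ≤ (κ * L) ^ 2 := by gcongr
    rw [hK]
    nlinarith
  refine exists_agnosticallySQLearnable_unitClass (by omega) hC hε (by positivity)
    (fun ρ h0 h1 => ?_) (fun ρ _ _ => eLpNorm_sigmoid_mul_le_one ρ) (fun ρ h0 h1 => ?_)
    (add_one_pow_le_rpow hn hd) ?_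
  · rw [← sigmoidDeriv_zero]
    exact memLp_sigmoidDeriv h0 h1 0
  · obtain ⟨p, hp, hpδ⟩ := exists_polynomial_sigmoid h0 h1 hm1
    exact ⟨p, hp, hpδ.trans (ENNReal.ofReal_le_ofReal hδ)⟩
  have hx : 0 < L ^ 2 := by positivity
  have h6 := rpow_neg_mul_sq_le (K := K) hn hcpos hx
  calc (n : ℝ) ^ (-((2 * K + c) * L ^ 2)) * ε ^ 2 * (64 * C ^ 2 * ((n : ℝ) ^ (K * L ^ 2)) ^ 2)
      = ε ^ 2 * (64 * C ^ 2) *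
        ((n : ℝ) ^ (-((2 * K + c) * L ^ 2)) * ((n : ℝ) ^ (K * L ^ 2)) ^ 2) := by ring
    _ ≤ ε ^ 2 * (64 * C ^ 2) * (2 / (c * L ^ 2)) := by gcongr
    _ = ε ^ 2 * (128 * C ^ 2 / (c * L ^ 2)) := by ring
    _ ≤ ε ^ 2 * 1 := by
      gcongr
      rw [div_le_one (by positivity), hc]
      have : 1 / 4 ≤ L ^ 2 := by nlinarith
      nlinarith [sq_nonneg C]
    _ = ε ^ 2 := mul_one _

end Main

theorem mainTheorem7 (C : ℝ) (hC : 0 < C) :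
    (∃ K c : ℝ, 0 < K ∧ 0 < c ∧
      ∀ n : ℕ, 2 ≤ n → ∀ ε : ℝ, 0 < ε →
        ∃ q : ℕ, (q : ℝ) ≤ (n : ℝ) ^ (K * ε ^ (-(4 / 3) : ℝ)) ∧
          AgnosticallySQLearnable (unitClass relu n) C ε q
            ((n : ℝ) ^ (-(c * ε ^ (-(4 / 3) : ℝ))) * ε)) ∧
    (∃ K c : ℝ, ∃ k l : ℕ, 0 < K ∧ 0 < c ∧
      ∀ n : ℕ, 2 ≤ n → ∀ ε : ℝ, 0 < ε → ε ≤ 1 / 2 →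
        ∃ q : ℕ, (q : ℝ) ≤ (n : ℝ) ^ (K * softLogSq k ε) ∧
          AgnosticallySQLearnable (unitClass Real.sigmoid n) C ε q
            ((n : ℝ) ^ (-(c * softLogSq l ε)) * ε ^ 2)) :=
  ⟨relu_learnable hC, sigmoid_learnable hC⟩
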